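/- Graphs are finite, may have multiple edges, have no loops, and may be empty; $K_0$ denotes the graph with no nodes. A graph parameter is a real-valued, isomorphism-invariant function $f$ on such graphs. For $k\ge 0$, a $k$-labeled graph is a graph in which $k$ distinct nodes carry the labels $1,\dots,k$ (there may be further, unlabeled nodes). The product $G_1G_2$ of two $k$-labeled graphs is obtained from their disjoint union by identifying nodes with the same label, keeping all edges with multiplicity. The connection matrix $M(f,k)$ has its rows and columns indexed by the isomorphism types of $k$-labeled graphs, with entry $f(G_1G_2)$ in row $G_1$ and column $G_2$. The parameter $f$ is reflection positive if $M(f,k)$ is positive semidefinite for every $k\ge 0$. A (finite) weighted graph $H$ consists of a finite node set $V(H)$, a real weight $\alpha_i>0$ for every node $i$, and a real symmetric matrix $(\beta_{ij})_{i,j\in V(H)}$ of edge weights, loops included; $V(H)=\emptyset$ is allowed. For a graph $G$, $$\hom(G,H)=\sum_{\phi:V(G)\to V(H)}\ \prod_{u\in V(G)}\alpha_{\phi(u)}\prod_{uv\in E(G)}\beta_{\phi(u)\phi(v)},$$ the last product being taken over the edges with multiplicity. Theorem. Let $f$ be a reflection positive graph parameter with $f(K_0)=1$, and suppose that there is a positive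 integer $q$ such that $\operatorname{rank} M(f,k)\le q^k$ for every $k\ge 0$. Then there is a finite weighted graph $H$ such that $f(G)=\hom(G,H)$ for every graph $G$. -/

import Mathlib

/-- A finite multigraph without loops: a finite node set `V` and a finite multiset of edges, each
of which is an unordered pair of two distinct nodes. The null graph (no nodes) is allowed. -/
structure Multigraph where
  /-- the node set -/
  V : Type
  [fintypeV : Fintype V]
  /-- the edges, with multiplicity -/
  E : Multiset (Sym2 V)
  loopless : ∀ e ∈ E, ¬ e.IsDiag

attribute [instance] Multigraph.fintypeV

namespace Multigraph

/-- An isomorphism of multigraphs: a bijection of the nodes preserving edge multiplicities. -/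
structure Iso (G₁ G₂ : Multigraph) where
  toEquiv : G₁.V ≃ G₂.V
  map_E : G₁.E.map (Sym2.map toEquiv) = G₂.E

/-- The graph `K₀` with no nodes and no edges. -/
def K₀ : Multigraph where
  V := Fin 0
  E := 0
  loopless := by simp

end Multigraph

/-- A real-valued graph parameter: a function on finite loopless multigraphs that is invariant
under isomorphism. -/
structure GraphParameter where
  toFun : Multigraph → ℝ
  iso_inv : ∀ G₁ G₂ : Multigraph, Nonempty (G₁.Iso G₂) → toFun G₁ = toFun G₂

instance : CoeFun GraphParameter (fun _ => Multigraph → ℝ) := ⟨GraphParameter.toFun⟩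

/-- A `k`-labeled graph: a multigraph in which `k` distinct nodes carry the labels
`0, …, k - 1`; there may be any number of unlabeled nodes. -/
structure LabeledMultigraph (k : ℕ) extends Multigraph where
  label : Fin k ↪ V

namespace LabeledMultigraph

variable {k : ℕ}

/-- A label-preserving isomorphism of `k`-labeled graphs. -/
structure Iso (G₁ G₂ : LabeledMultigraph k) extends
    Multigraph.Iso G₁.toMultigraph G₂.toMultigraph where
  map_label : ∀ i, toEquiv (G₁.label i) = G₂.label i

/-- Isomorphism as an equivalence relation on `k`-labeled graphs. -/
instance isoSetoid (k : ℕ) : Setoid (LabeledMultigraph k) where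
  r G₁ G₂ := Nonempty (Iso G₁ G₂)
  iseqv :=
    { refl := fun G => ⟨{ toEquiv := Equiv.refl _, map_E := by simp, map_label := fun _ => rfl }⟩
      symm := by
        rintro G₁ G₂ ⟨e⟩
        refine ⟨{ toEquiv := e.toEquiv.symm, map_E := ?_, map_label := fun i => ?_ }⟩
        · rw [← e.map_E, Multiset.map_map]
          simp [Sym2.map_map]
        · rw [← e.map_label, Equiv.symm_apply_apply]
      trans := by
        rintro G₁ G₂ G₃ ⟨e⟩ ⟨e'⟩
        refine ⟨{ toEquiv := e.toEquiv.trans e'.toEquiv, map_E := ?_, map_label := fun i => ?_ }⟩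
        · rw [← e'.map_E, ← e.map_E, Multiset.map_map]
          simp [Function.comp_def, Sym2.map_map]
        · simp [e.map_label, e'.map_label] }

/-- In the disjoint union of the node sets, nodes with the same label are to be identified. -/
def GlueRel (G₁ G₂ : LabeledMultigraph k) (x y : G₁.V ⊕ G₂.V) : Prop :=
  ∃ i, x = Sum.inl (G₁.label i) ∧ y = Sum.inr (G₂.label i)

/-- The node set of the product: the disjoint union with equally labeled nodes identified. -/
def GlueV (G₁ G₂ : LabeledMultigraph k) : Type := Quot (GlueRel G₁ G₂)

/-- The map from the nodes of the first factor to the nodes of the product. -/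
def glueInl (G₁ G₂ : LabeledMultigraph k) (v : G₁.V) : GlueV G₁ G₂ := Quot.mk _ (Sum.inl v)

/-- The map from the nodes of the second factor to the nodes of the product. -/
def glueInr (G₁ G₂ : LabeledMultigraph k) (v : G₂.V) : GlueV G₁ G₂ := Quot.mk _ (Sum.inr v)

theorem glueInl_injective (G₁ G₂ : LabeledMultigraph k) :
    Function.Injective (glueInl G₁ G₂) := by
  classical
  let F : GlueV G₁ G₂ → Option G₁.V := Quot.lift
    (Sum.elim some (fun w => if h : ∃ i, G₂.label i = w then some (G₁.label h.choose) else none))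
    (by
      rintro _ _ ⟨i, rfl, rfl⟩
      have h : ∃ j, G₂.label j = G₂.label i := ⟨i, rfl⟩
      have h2 : h.choose = i := G₂.label.injective h.choose_spec
      simp only [Sum.elim_inl, Sum.elim_inr, dif_pos h, h2])
  intro v w hvw
  have h : F (glueInl G₁ G₂ v) = F (glueInl G₁ G₂ w) := congrArg F hvw
  exact Option.some.inj h

theorem glueInr_injective (G₁ G₂ : LabeledMultigraph k) :
    Function.Injective (glueInr G₁ G₂) := by
  classical
  let F : GlueV G₁ G₂ → Option G₂.V := Quot.lift
    (Sum.elim (fun w => if h : ∃ i, G₁.label i = w then some (G₂.label h.choose) else none) some)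
    (by
      rintro _ _ ⟨i, rfl, rfl⟩
      have h : ∃ j, G₁.label j = G₁.label i := ⟨i, rfl⟩
      have h2 : h.choose = i := G₁.label.injective h.choose_spec
      simp only [Sum.elim_inl, Sum.elim_inr, dif_pos h, h2])
  intro v w hvw
  have h : F (glueInr G₁ G₂ v) = F (glueInr G₁ G₂ w) := congrArg F hvw
  exact Option.some.inj h

theorem not_isDiag_map {α β : Type} {g : α → β} (hg : Function.Injective g) (e : Sym2 α)
    (he : ¬ e.IsDiag) : ¬ (e.map g).IsDiag := by
  induction e with
  | h x y => simpa [hg.eq_iff] using he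

/-- The product `G₁G₂` of two `k`-labeled graphs: their disjoint union, with nodes carrying the
same label identified. All edges are kept (multiplicities add up). -/
noncomputable def glue (G₁ G₂ : LabeledMultigraph k) : LabeledMultigraph k where
  V := GlueV G₁ G₂
  fintypeV :=
    haveI : Finite (GlueV G₁ G₂) := inferInstanceAs (Finite (Quot _))
    Fintype.ofFinite _
  E := G₁.E.map (Sym2.map (glueInl G₁ G₂)) + G₂.E.map (Sym2.map (glueInr G₁ G₂))
  loopless := by
    intro e he
    rcases Multiset.mem_add.1 he with h | h
    · obtain ⟨a, ha, rfl⟩ := Multiset.mem_map.1 h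
      exact not_isDiag_map (glueInl_injective G₁ G₂) a (G₁.loopless a ha)
    · obtain ⟨a, ha, rfl⟩ := Multiset.mem_map.1 h
      exact not_isDiag_map (glueInr_injective G₁ G₂) a (G₂.loopless a ha)
  label := ⟨fun i => glueInl G₁ G₂ (G₁.label i),
    (glueInl_injective G₁ G₂).comp G₁.label.injective⟩

/-- Gluing respects isomorphism. -/
theorem glue_iso {G₁ G₂ G₁' G₂' : LabeledMultigraph k} (e₁ : Iso G₁ G₁') (e₂ : Iso G₂ G₂') :
    Nonempty (Iso (glue G₁ G₂) (glue G₁' G₂')) := by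
  let e : GlueV G₁ G₂ ≃ GlueV G₁' G₂' :=
    Quot.congr (Equiv.sumCongr e₁.toEquiv e₂.toEquiv) (by
      intro x y
      constructor
      · rintro ⟨i, rfl, rfl⟩
        exact ⟨i, by simp [e₁.map_label], by simp [e₂.map_label]⟩
      · rintro ⟨i, hx, hy⟩
        refine ⟨i, ?_, ?_⟩
        · apply (Equiv.sumCongr e₁.toEquiv e₂.toEquiv).injective
          rw [hx]
          simp [e₁.map_label]
        · apply (Equiv.sumCongr e₁.toEquiv e₂.toEquiv).injective
          rw [hy]
          simp [e₂.map_label])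
  have hl : ∀ v, e (glueInl G₁ G₂ v) = glueInl G₁' G₂' (e₁.toEquiv v) := fun _ => rfl
  have hr : ∀ v, e (glueInr G₁ G₂ v) = glueInr G₁' G₂' (e₂.toEquiv v) := fun _ => rfl
  refine ⟨{ toEquiv := e, map_E := ?_, map_label := fun i => ?_ }⟩
  · have h₁ : (G₁.E.map (Sym2.map (glueInl G₁ G₂))).map (Sym2.map e) =
        G₁'.E.map (Sym2.map (glueInl G₁' G₂')) := by
      rw [← e₁.map_E]
      simp only [Multiset.map_map, Function.comp_def, Sym2.map_map, hl]
    have h₂ : (G₂.E.map (Sym2.map (glueInr G₁ G₂))).map (Sym2.map e) =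
        G₂'.E.map (Sym2.map (glueInr G₁' G₂')) := by
      rw [← e₂.map_E]
      simp only [Multiset.map_map, Function.comp_def, Sym2.map_map, hr]
    exact (Multiset.map_add _ _ _).trans (congrArg₂ (· + ·) h₁ h₂)
  · change e (glueInl G₁ G₂ (G₁.label i)) = glueInl G₁' G₂' (G₁'.label i)
    rw [hl, e₁.map_label]

end LabeledMultigraph

/-- Isomorphism types of `k`-labeled graphs. -/
abbrev LabeledType (k : ℕ) := Quotient (LabeledMultigraph.isoSetoid k)

namespace GraphParameter

/-- The connection matrix `M(f, k)`: rows and columns are indexed by isomorphism types of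
`k`-labeled graphs and the entry at `(G₁, G₂)` is `f (G₁G₂)`. -/
noncomputable def connectionMatrix (f : GraphParameter) (k : ℕ) :
    Matrix (LabeledType k) (LabeledType k) ℝ :=
  Matrix.of (Quotient.lift₂ (fun G₁ G₂ => f (LabeledMultigraph.glue G₁ G₂).toMultigraph)
    (by
      rintro G₁ G₂ G₁' G₂' ⟨e₁⟩ ⟨e₂⟩
      obtain ⟨e⟩ := LabeledMultigraph.glue_iso e₁ e₂
      exact f.iso_inv _ _ ⟨e.toIso⟩))

/-- `f` is reflection positive if all its connection matrices are positive semidefinite. -/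
def ReflectionPositive (f : GraphParameter) : Prop :=
  ∀ k : ℕ, (f.connectionMatrix k).PosSemidef

/-- The rank connectivity function `r_f(k) = rk M(f, k)`, possibly infinite. -/
noncomputable def rankConn (f : GraphParameter) (k : ℕ) : ℕ∞ :=
  (f.connectionMatrix k).eRank

end GraphParameter

/-- A finite weighted graph: `d` nodes with positive real weights, and real symmetric edge weights
on all pairs of nodes, loops included (an absent edge has weight `0`). -/
structure WeightedGraph where
  d : ℕ
  α : Fin d → ℝ
  α_pos : ∀ i, 0 < α i
  β : Matrix (Fin d) (Fin d) ℝ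
  β_symm : β.IsSymm

namespace WeightedGraph

/-- The weight of the (possibly degenerate) unordered pair of nodes. -/
def edgeWeight (H : WeightedGraph) : Sym2 (Fin H.d) → ℝ :=
  Sym2.lift ⟨fun i j => H.β i j, fun i j => H.β_symm.apply j i⟩

open Classical in
/-- `hom(G, H)`: the sum over all maps `φ : V(G) → V(H)` of the product of the node weights
`α (φ u)`, `u ∈ V(G)`, and the edge weights `β (φ u) (φ v)`, `uv ∈ E(G)` with multiplicity. -/
noncomputable def hom (G : Multigraph) (H : WeightedGraph) : ℝ :=
  ∑ φ : G.V → Fin H.d, (∏ u, H.α (φ u)) * (G.E.map (fun e => H.edgeWeight (e.map φ))).prod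

end WeightedGraph

/-! Suppose first that `f` is positive on the one-node graph, and divide `f G` by that value to the
power of the number of nodes. Isolated nodes then no longer count, so graphs partially labeled from
`ℕ` form one commutative monoid, in which label sets can grow without changing the objects. Let `F`
be the normalized parameter and `A S` the submonoid of elements with labels in `S`.

Reflection positivity says that `F (s * t)` is a positive semidefinite kernel on `A S`, and the rank
bound says that the translates of `F` by `A S` span at most `q ^ |S|` dimensions. On this span the
translations are commuting self-adjoint operators; diagonalizing them simultaneously writes `F` as a
positive combination of a finite set `P S` of functions multiplicative over `A S`
(`exists_multiplicative_decomposition`). Characters are linearly independent, so the weights are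
unique (`sum_filter_agree_eq`), and each `φ ∈ P S` is a positive combination of its extensions in `P
T` for `T ⊇ S` (`eq_sum_fib`).

Given `φ`, disjoint sets of further labels are independent (`agree_of_inter`). Hence the number of
one-label extensions never drops on passing from `φ` to an extension of it (`card_fib_insert_mono`),
and it cannot exceed `q`, since otherwise `P T` would outgrow `q ^ |T|` (`card_fib_insert_le_q`).
Take `φ` with the largest number. Above it no new branching occurs: `φ` is a sum, with product
weights, over all assignments of its one-label extensions to `n` fresh labels
(`IsMaximal.exists_family`).

The one-label extensions of this `φ` are the nodes of `H`, their weights relative to `φ` are the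
node weights, and the values of two-label extensions on a single edge are the edge weights. Elements
with labels outside `S` do not distinguish `φ` from `F` (`eq_F_of_disjoint`), and each term of the
sum factors over the edges, so the sum is a homomorphism number (`exists_weights`). If `f` vanishes
on the one-node graph, positivity makes it vanish on every graph with a node, and the empty `H`
works. -/

/-! ### Positive semidefinite functions on a commutative monoid as combinations of characters -/

section CharacterDecomposition

open Module.End

variable {N : Type*} [CommMonoid N]

/-- The mulTranslate `x ↦ F (s * x)` of a function on a commutative monoid. -/
def mulTranslate (F : N → ℝ) (s : N) : N → ℝ := fun x => F (s * x)

/-- The span of the translates of `F` by the elements of a submonoid. -/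
def translateSpan (A : Submonoid N) (F : N → ℝ) : Submodule ℝ (N → ℝ) :=
  Submodule.span ℝ (Set.range fun s : A => mulTranslate F s)

theorem mem_translateSpan_iff {A : Submonoid N} {F h : N → ℝ} :
    h ∈ translateSpan A F ↔
      ∃ c : A →₀ ℝ, Finsupp.linearCombination ℝ (fun s : A => mulTranslate F s) c = h := by
  rw [translateSpan, Finsupp.mem_span_range_iff_exists_finsupp]
  rfl

theorem linearCombination_translate_apply {A : Submonoid N} (F : N → ℝ) (c : A →₀ ℝ) (x : N) :
    Finsupp.linearCombination ℝ (fun s : A => mulTranslate F s) c x =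
      Finsupp.linearCombination ℝ (fun s : A => F (s * x)) c := by
  simp [Finsupp.linearCombination_apply, Finsupp.sum, mulTranslate]

theorem self_mem_translateSpan (A : Submonoid N) (F : N → ℝ) : F ∈ translateSpan A F :=
  Submodule.subset_span ⟨1, by ext x; simp [mulTranslate]⟩

theorem translate_mem_translateSpan {A : Submonoid N} {F h : N → ℝ} (hh : h ∈ translateSpan A F)
    {s : N} (hs : s ∈ A) : mulTranslate h s ∈ translateSpan A F := by
  obtain ⟨c, rfl⟩ := mem_translateSpan_iff.1 hh
  refine mem_translateSpan_iff.2 ⟨c.mapDomain fun t => (⟨s, hs⟩ : A) * t, ?_⟩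
  ext x
  rw [linearCombination_translate_apply, Finsupp.linearCombination_mapDomain, mulTranslate,
    linearCombination_translate_apply]
  congr 2
  ext t
  simp only [Function.comp_apply, Submonoid.coe_mul]
  congr 1
  rw [mul_comm s, mul_assoc]

/-- At every point both sides are the same double sum of values of `F`. This symmetry makes
`translateInner` independent of the coefficients chosen to represent its arguments. -/
theorem linearCombination_translate_comm {A : Submonoid N} (F : N → ℝ) (c d : A →₀ ℝ) :
    Finsupp.linearCombination ℝ
      (fun t : A => Finsupp.linearCombination ℝ (fun s : A => mulTranslate F s) c t) d =
    Finsupp.linearCombination ℝ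
      (fun t : A => Finsupp.linearCombination ℝ (fun s : A => mulTranslate F s) d t) c := by
  simp only [linearCombination_translate_apply]
  simp only [Finsupp.linearCombination_apply, Finsupp.sum, smul_eq_mul, Finset.mul_sum]
  rw [Finset.sum_comm]
  refine Finset.sum_congr rfl fun i _ => Finset.sum_congr rfl fun j _ => ?_
  rw [mul_comm (i : N)]
  ring

/-- The pairing of two elements of the span of the translates of `F`, which on translates by `s`
and `t` is `F (s * t)`. -/
noncomputable def translateInner {A : Submonoid N} {F : N → ℝ} (h k : translateSpan A F) : ℝ :=
  Finsupp.linearCombination ℝ (fun s : A => h.1 s) (mem_translateSpan_iff.1 k.2).choose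

theorem translateInner_eq {A : Submonoid N} {F : N → ℝ} (h k : translateSpan A F) {d : A →₀ ℝ}
    (hd : Finsupp.linearCombination ℝ (fun s : A => mulTranslate F s) d = k.1) :
    translateInner h k = Finsupp.linearCombination ℝ (fun s : A => h.1 s) d := by
  obtain ⟨c, hc⟩ := mem_translateSpan_iff.1 h.2
  rw [translateInner, ← hc, linearCombination_translate_comm F c,
    linearCombination_translate_comm F c, (mem_translateSpan_iff.1 k.2).choose_spec, hd]

theorem translateInner_comm {A : Submonoid N} {F : N → ℝ} (h k : translateSpan A F) :
    translateInner h k = translateInner k h := by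
  obtain ⟨c, hc⟩ := mem_translateSpan_iff.1 h.2
  obtain ⟨d, hd⟩ := mem_translateSpan_iff.1 k.2
  rw [translateInner_eq h k hd, translateInner_eq k h hc, ← hc, ← hd,
    linearCombination_translate_comm]

/-- `F` is positive semidefinite on the submonoid `A`. -/
def PosSemidefOn (A : Submonoid N) (F : N → ℝ) : Prop :=
  ∀ c : A →₀ ℝ, 0 ≤ c.sum fun i a => c.sum fun j b => a * F (i * j) * b

theorem translateInner_self_nonneg {A : Submonoid N} {F : N → ℝ} (hpos : PosSemidefOn A F)
    (h : translateSpan A F) : 0 ≤ translateInner h h := by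
  obtain ⟨c, hc⟩ := mem_translateSpan_iff.1 h.2
  refine (hpos c).trans_eq ?_
  rw [translateInner_eq h h hc, ← hc]
  simp only [linearCombination_translate_apply]
  simp only [Finsupp.linearCombination_apply, Finsupp.sum, smul_eq_mul, Finset.mul_sum]
  refine Finset.sum_congr rfl fun i _ => Finset.sum_congr rfl fun j _ => ?_
  rw [mul_comm (i : N)]
  ring

theorem translateInner_translate {A : Submonoid N} {F : N → ℝ} (h : translateSpan A F) (s : A) :
    translateInner h ⟨mulTranslate F s, Submodule.subset_span ⟨s, rfl⟩⟩ = h.1 s := by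
  rw [translateInner_eq (d := Finsupp.single s 1) _ _ (by simp)]
  simp

theorem translateInner_add_left {A : Submonoid N} {F : N → ℝ} (h k l : translateSpan A F) :
    translateInner (h + k) l = translateInner h l + translateInner k l := by
  simp [translateInner, Finsupp.linearCombination_apply, Finsupp.sum, mul_add,
    Finset.sum_add_distrib]

theorem translateInner_smul_left {A : Submonoid N} {F : N → ℝ} (h k : translateSpan A F) (r : ℝ) :
    translateInner (r • h) k = r * translateInner h k := by
  simp only [translateInner, Finsupp.linearCombination_apply, Finsupp.sum, Finset.mul_sum,
    smul_eq_mul, Submodule.coe_smul, Pi.smul_apply]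
  exact Finset.sum_congr rfl fun _ _ => by ring

/-- For a null vector `h`, the square norm of `t • h + r` is affine in `t` with slope `2 * h s`,
where `r` is the translate by `s`. Nonnegativity for all `t` forces `h s = 0`. -/
theorem translateInner_eq_zero {A : Submonoid N} {F : N → ℝ} (hpos : PosSemidefOn A F)
    (hdef : ∀ h ∈ translateSpan A F, (∀ s ∈ A, h s = 0) → h = 0)
    (h : translateSpan A F) (hh : translateInner h h = 0) : h = 0 := by
  refine Subtype.ext (hdef _ h.2 fun s hs => ?_)
  set r : translateSpan A F := ⟨mulTranslate F s, Submodule.subset_span ⟨⟨s, hs⟩, rfl⟩⟩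
  have hr : translateInner h r = h.1 s := translateInner_translate h ⟨s, hs⟩
  by_contra hne
  have key : ∀ t : ℝ, 0 ≤ 2 * t * h.1 s + translateInner r r := by
    intro t
    have h1 := translateInner_self_nonneg hpos (t • h + r)
    have h2 : translateInner r (t • h + r) = t * h.1 s + translateInner r r := by
      rw [translateInner_comm, translateInner_add_left, translateInner_smul_left, hr]
    have h3 : translateInner h (t • h + r) = h.1 s := by
      rw [translateInner_comm, translateInner_add_left, translateInner_smul_left, hh,
        translateInner_comm r, hr]
      ring
    rw [translateInner_add_left, translateInner_smul_left, h2, h3] at h1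
    linarith
  -- This `t` gives the affine function the value `-1`.
  have := key (-(translateInner r r + 1) / (2 * h.1 s))
  have h2 : 2 * (-(translateInner r r + 1) / (2 * h.1 s)) * h.1 s = -(translateInner r r + 1) := by
    field_simp
  linarith

/-- The inner product given by `translateInner`. -/
noncomputable abbrev translateCore {A : Submonoid N} {F : N → ℝ} (hpos : PosSemidefOn A F)
    (hdef : ∀ h ∈ translateSpan A F, (∀ s ∈ A, h s = 0) → h = 0) :
    InnerProductSpace.Core ℝ (translateSpan A F) where
  inner := translateInner
  conj_inner_symm h k := translateInner_comm k h
  re_inner_nonneg h := translateInner_self_nonneg hpos h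
  add_left := translateInner_add_left
  smul_left h k r := translateInner_smul_left h k r
  definite h := translateInner_eq_zero hpos hdef h

/-- Translation by an element of `A` as an endomorphism of the span of the translates. -/
def translateEnd (A : Submonoid N) (F : N → ℝ) (s : A) : Module.End ℝ (translateSpan A F) where
  toFun h := ⟨mulTranslate h.1 s, translate_mem_translateSpan h.2 s.2⟩
  map_add' _ _ := rfl
  map_smul' _ _ := rfl

/-- Commutativity lets the factor `s` move between the two arguments, so translations are
self-adjoint. -/
theorem translateInner_translateEnd {A : Submonoid N} {F : N → ℝ} (s : A)
    (h k : translateSpan A F) :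
    translateInner (translateEnd A F s h) k = translateInner h (translateEnd A F s k) := by
  obtain ⟨d, hd⟩ := mem_translateSpan_iff.1 k.2
  rw [translateInner_eq _ k hd, translateInner_eq (d := d.mapDomain fun t => s * t)]
  · rw [Finsupp.linearCombination_mapDomain]
    rfl
  · ext x
    rw [linearCombination_translate_apply, Finsupp.linearCombination_mapDomain]
    change _ = k.1 (s * x)
    rw [← hd, linearCombination_translate_apply]
    congr 2
    ext t
    simp only [Function.comp_apply, Submonoid.coe_mul]
    congr 1
    rw [mul_comm (s : N), mul_assoc]

/-- A positive semidefinite function whose translates span a finite-dimensional space is a positive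
combination of functions that are multiplicative over the submonoid. -/
theorem exists_multiplicative_decomposition (A : Submonoid N) (F : N → ℝ)
    (hfin : FiniteDimensional ℝ (translateSpan A F)) (hpos : PosSemidefOn A F)
    (hdef : ∀ h ∈ translateSpan A F, (∀ s ∈ A, h s = 0) → h = 0) :
    ∃ (P : Finset (N → ℝ)) (w : (N → ℝ) → ℝ),
      (∀ φ ∈ P, 0 < w φ) ∧
      (∀ φ ∈ P, φ ∈ translateSpan A F ∧ φ 1 = 1 ∧ ∀ s ∈ A, ∀ x, φ (s * x) = φ s * φ x) ∧
      (∀ φ ∈ P, ∀ ψ ∈ P, (∀ s ∈ A, φ s = ψ s) → φ = ψ) ∧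
      (∀ x, F x = ∑ φ ∈ P, w φ * φ x) ∧
      P.card ≤ Module.finrank ℝ (translateSpan A F) := by
  classical
  let core := translateCore hpos hdef
  let _ : NormedAddCommGroup (translateSpan A F) := core.toNormedAddCommGroup
  let _ : InnerProductSpace ℝ (translateSpan A F) := InnerProductSpace.ofCore core.toCore
  have hinner : ∀ h k : translateSpan A F, inner ℝ h k = translateInner h k := fun _ _ => rfl
  have hsymm : ∀ s, (translateEnd A F s).IsSymmetric := fun s h k =>
    translateInner_translateEnd s h k
  have hcomm : Pairwise (Function.onFun Commute (translateEnd A F)) := by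
    intro s t _
    refine LinearMap.ext fun h => Subtype.ext (funext fun x => ?_)
    change h.1 (t * (s * x)) = h.1 (s * (t * x))
    rw [mul_left_comm]
  -- Simultaneous diagonalization: `F` is a sum of orthogonal joint eigenvectors `v χ`, with `χ` the
  -- system of eigenvalues.
  have htop := LinearMap.IsSymmetric.iSup_iInf_eq_top_of_commute hsymm hcomm
  have horth := LinearMap.IsSymmetric.orthogonalFamily_iInf_eigenspaces hsymm
  let u : translateSpan A F := ⟨F, self_mem_translateSpan A F⟩
  have hu : u ∈ ⨆ χ : A → ℝ, ⨅ i, eigenspace (translateEnd A F i) (χ i) := htop ▸ Submodule.mem_top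
  obtain ⟨v, hv, hsum⟩ := (Submodule.mem_iSup_iff_exists_finsupp _ _).1 hu
  -- Pairing with `F` is evaluation at `1`. By orthogonality `v χ` takes at `1` the value of its own
  -- square norm, so it can be normalized there and its weight is positive.
  have hvu : ∀ h : translateSpan A F, inner ℝ h u = h.1 1 := by
    intro h
    rw [hinner, ← OneMemClass.coe_one A, ← translateInner_translate]
    congr 2
    ext x
    simp [mulTranslate, u]
  have heig : ∀ χ (s : A) (x : N), (v χ).1 (s * x) = χ s * (v χ).1 x := by
    intro χ s x
    have h1 := (Submodule.mem_iInf _).1 (hv χ) s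
    exact congrFun (congrArg Subtype.val (mem_eigenspace_iff.1 h1)) x
  have hone : ∀ χ, (v χ).1 1 = inner ℝ (v χ) (v χ) := by
    intro χ
    rw [← hvu, ← hsum, Finsupp.sum, inner_sum]
    refine (Finset.sum_eq_single χ (fun ψ _ hψ => ?_) (fun hχ => ?_))
    · exact horth (Ne.symm hψ) ⟨v χ, hv χ⟩ ⟨v ψ, hv ψ⟩
    · simp [Finsupp.notMem_support_iff.1 hχ]
  have honepos : ∀ χ ∈ v.support, 0 < (v χ).1 1 := by
    intro χ hχ
    rw [hone]
    exact real_inner_self_pos.2 (Finsupp.mem_support_iff.1 hχ)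
  let φ : (A → ℝ) → N → ℝ := fun χ x => ((v χ).1 1)⁻¹ * (v χ).1 x
  have hφA : ∀ χ ∈ v.support, ∀ s : A, φ χ s = χ s := by
    intro χ hχ s
    have := heig χ s 1
    rw [mul_one] at this
    change ((v χ).1 1)⁻¹ * (v χ).1 s = _
    rw [this]
    field_simp [(honepos χ hχ).ne']
  have hinj : Set.InjOn φ v.support := by
    intro χ hχ ψ hψ h
    ext s
    rw [← hφA χ hχ, ← hφA ψ hψ, h]
  -- Weights are indexed by functions rather than by eigenvalue systems, so `φ` has to be inverted
  -- on the support.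
  obtain ⟨w, hw⟩ : ∃ w : (N → ℝ) → ℝ, ∀ χ ∈ v.support, w (φ χ) = (v χ).1 1 := by
    refine ⟨fun p => (v (Function.invFunOn φ v.support p)).1 1, fun χ hχ => ?_⟩
    beta_reduce
    rw [hinj.leftInvOn_invFunOn hχ]
  refine ⟨v.support.image φ, w, ?_, ?_, ?_, ?_, ?_⟩
  · simp only [Finset.forall_mem_image]
    intro χ hχ
    rw [hw χ hχ]
    exact honepos χ hχ
  · simp only [Finset.forall_mem_image]
    intro χ hχ
    have hne := (honepos χ hχ).ne'
    refine ⟨Submodule.smul_mem _ _ (v χ).2, inv_mul_cancel₀ hne, fun s hs x => ?_⟩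
    rw [hφA χ hχ ⟨s, hs⟩]
    change _ * _ = _ * (_ * _)
    rw [heig χ ⟨s, hs⟩ x]
    ring
  · simp only [Finset.forall_mem_image]
    intro χ hχ ψ hψ h
    congr 1
    ext s
    rw [← hφA χ hχ, ← hφA ψ hψ, h s s.2]
  · intro x
    rw [Finset.sum_image hinj]
    have h1 : F x = (∑ χ ∈ v.support, v χ).1 x := by
      change u.1 x = _
      rw [← hsum]
      rfl
    rw [h1, Submodule.coe_sum, Finset.sum_apply]
    refine Finset.sum_congr rfl fun χ hχ => ?_
    rw [hw χ hχ]
    change _ = _ * (_ * _)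
    field_simp [(honepos χ hχ).ne']
  · rw [Finset.card_image_of_injOn hinj]
    have hli : LinearIndependent ℝ fun χ : v.support => v χ :=
      LinearIndependent.comp (ι := {χ // v χ ≠ 0}) (f := fun χ : v.support =>
        (⟨χ.1, Finsupp.mem_support_iff.1 χ.2⟩ : {χ // v χ ≠ 0})) (v := fun χ => v χ.1)
        (linearIndependent_of_ne_zero_of_inner_eq_zero (fun χ => χ.2) fun χ ψ hne =>
          horth (fun h => hne (Subtype.ext h)) ⟨v χ, hv χ⟩ ⟨v ψ, hv ψ⟩)
        (fun χ ψ h => Subtype.ext (congrArg (fun z => z.1) h))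
    simpa using hli.fintype_card_le_finrank

end CharacterDecomposition

/-! ### Uniqueness of the coefficients of characters -/

section Comparison

variable {N : Type*} [CommMonoid N]

/-- `φ` is normalized and multiplicative over the submonoid `A`. -/
def IsMulOver (A : Submonoid N) (φ : N → ℝ) : Prop :=
  φ 1 = 1 ∧ ∀ s ∈ A, ∀ x, φ (s * x) = φ s * φ x

theorem IsMulOver.mono {A B : Submonoid N} (h : A ≤ B) {φ : N → ℝ} (hφ : IsMulOver B φ) :
    IsMulOver A φ :=
  ⟨hφ.1, fun s hs => hφ.2 s (h hs)⟩

theorem IsMulOver.map_multiset_prod {A : Submonoid N} {φ : N → ℝ} (hφ : IsMulOver A φ)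
    {ι : Type*} (E : Multiset ι) (e : ι → N) (he : ∀ i ∈ E, e i ∈ A) :
    φ (E.map e).prod = (E.map fun i => φ (e i)).prod := by
  induction E using Multiset.induction_on with
  | empty => simpa using hφ.1
  | cons i E ih =>
    rw [Multiset.map_cons, Multiset.prod_cons, Multiset.map_cons, Multiset.prod_cons,
      hφ.2 _ (he i (Multiset.mem_cons_self i E)), ih fun j hj => he j (Multiset.mem_cons_of_mem hj)]

/-- The restriction of a function multiplicative over `A` to a character of `A`. -/
def IsMulOver.restrict {A : Submonoid N} {φ : N → ℝ} (hφ : IsMulOver A φ) : A →* ℝ where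
  toFun s := φ s
  map_one' := hφ.1
  map_mul' s t := hφ.2 s s.2 t

open Classical in
/-- If two linear combinations of functions multiplicative over `A` agree on `A`, then the
coefficients belonging to each character of `A` agree. -/
theorem sum_filter_agree_eq {ι κ : Type*} (A : Submonoid N) (P : Finset ι) (Q : Finset κ)
    (Φ : ι → N → ℝ) (Ψ : κ → N → ℝ) (a : ι → ℝ) (b : κ → ℝ)
    (hΦ : ∀ i ∈ P, IsMulOver A (Φ i)) (hΨ : ∀ j ∈ Q, IsMulOver A (Ψ j))
    (h : ∀ y ∈ A, ∑ i ∈ P, a i * Φ i y = ∑ j ∈ Q, b j * Ψ j y)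
    {χ : N → ℝ} (hχ : IsMulOver A χ) :
    ∑ i ∈ P with ∀ s ∈ A, Φ i s = χ s, a i = ∑ j ∈ Q with ∀ s ∈ A, Ψ j s = χ s, b j := by
  -- The value `1` is a dummy: `r` is only evaluated on functions multiplicative over `A`.
  let r : (N → ℝ) → (A →* ℝ) := fun φ => if hφ : IsMulOver A φ then hφ.restrict else 1
  have hr : ∀ φ, IsMulOver A φ → ∀ s : A, r φ s = φ s := by
    intro φ hφ s
    simp only [r, dif_pos hφ]
    rfl
  have hagree : ∀ φ, IsMulOver A φ → ((∀ s ∈ A, φ s = χ s) ↔ r φ = r χ) := by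
    intro φ hφ
    constructor
    · intro h1
      ext s
      rw [hr φ hφ, hr χ hχ, h1 s s.2]
    · intro h1 s hs
      rw [← hr φ hφ ⟨s, hs⟩, ← hr χ hχ ⟨s, hs⟩, h1]
  let R : Finset (A →* ℝ) := insert (r χ) (P.image (r ∘ Φ) ∪ Q.image (r ∘ Ψ))
  have hPR : ∀ i ∈ P, r (Φ i) ∈ R := fun i hi => by
    simp only [R, Finset.mem_insert, Finset.mem_union]
    exact Or.inr (Or.inl (Finset.mem_image_of_mem (r ∘ Φ) hi))
  have hQR : ∀ j ∈ Q, r (Ψ j) ∈ R := fun j hj => by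
    simp only [R, Finset.mem_insert, Finset.mem_union]
    exact Or.inr (Or.inr (Finset.mem_image_of_mem (r ∘ Ψ) hj))
  -- Dedekind's independence of characters, applied to the difference of the two combinations after
  -- grouping terms with the same restriction to `A`.
  have key := linearIndependent_iff'.1 (linearIndependent_monoidHom A ℝ) R
    (fun f => ∑ i ∈ P with r (Φ i) = f, a i - ∑ j ∈ Q with r (Ψ j) = f, b j) ?_ (r χ)
    (Finset.mem_insert_self _ _)
  · rw [sub_eq_zero] at key
    rw [Finset.filter_congr fun i hi => hagree _ (hΦ i hi),
      Finset.filter_congr fun j hj => hagree _ (hΨ j hj)]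
    exact key
  · ext s
    simp only [Finset.sum_apply, Pi.smul_apply, smul_eq_mul, sub_mul, Finset.sum_sub_distrib,
      Pi.zero_apply, sub_eq_zero]
    calc ∑ f ∈ R, (∑ i ∈ P with r (Φ i) = f, a i) * f s
        = ∑ f ∈ R, ∑ i ∈ P with r (Φ i) = f, a i * Φ i s := by
          refine Finset.sum_congr rfl fun f _ => ?_
          rw [Finset.sum_mul]
          refine Finset.sum_congr rfl fun i hi => ?_
          rw [← (Finset.mem_filter.1 hi).2, hr _ (hΦ i (Finset.mem_filter.1 hi).1)]
      _ = ∑ i ∈ P, a i * Φ i s := Finset.sum_fiberwise_of_maps_to hPR _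
      _ = ∑ j ∈ Q, b j * Ψ j s := h s s.2
      _ = ∑ f ∈ R, ∑ j ∈ Q with r (Ψ j) = f, b j * Ψ j s :=
          (Finset.sum_fiberwise_of_maps_to hQR _).symm
      _ = ∑ f ∈ R, (∑ j ∈ Q with r (Ψ j) = f, b j) * f s := by
          refine Finset.sum_congr rfl fun f _ => ?_
          rw [Finset.sum_mul]
          refine Finset.sum_congr rfl fun j hj => ?_
          rw [← (Finset.mem_filter.1 hj).2, hr _ (hΨ j (Finset.mem_filter.1 hj).1)]

end Comparison

/-! ### Label systems: decompositions over different label sets -/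

/-- A reflection positive function of exponentially bounded rank on a commutative monoid of
partially labeled objects, with labels in `ℕ`. -/
structure LabelSystem (N : Type*) [CommMonoid N] where
  /-- the objects with labels in a given set -/
  A : Finset ℕ → Submonoid N
  mono : ∀ {S T}, S ⊆ T → A S ≤ A T
  exhaust : ∀ x, ∃ S, x ∈ A S
  /-- relabeling -/
  act : Equiv.Perm ℕ → N →* N
  act_one : ∀ x, act 1 x = x
  act_mul : ∀ σ τ x, act (σ * τ) x = act σ (act τ x)
  act_congr : ∀ {S x σ τ}, x ∈ A S → (∀ i ∈ S, σ i = τ i) → act σ x = act τ x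
  act_mem : ∀ {S x} (σ : Equiv.Perm ℕ), x ∈ A S → act σ x ∈ A (S.image σ)
  /-- the invariant -/
  F : N → ℝ
  F_one : F 1 = 1
  F_act : ∀ σ x, F (act σ x) = F x
  /-- removing the labels outside `U` -/
  unlabel : ∀ {T x} U, x ∈ A T → ∃ x' ∈ A (T ∩ U), ∀ y ∈ A U, F (y * x) = F (y * x')
  pos : ∀ S, PosSemidefOn (A S) F
  /-- the growth rate of the ranks -/
  q : ℕ
  q_pos : 0 < q
  fin : ∀ S, FiniteDimensional ℝ (translateSpan (A S) F)
  rank_le : ∀ S, Module.finrank ℝ (translateSpan (A S) F) ≤ q ^ S.card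

namespace LabelSystem

variable {N : Type*} [CommMonoid N] (L : LabelSystem N) {S T U : Finset ℕ} {φ χ ξ : N → ℝ}

theorem exists_unlabel {x : N} (U : Finset ℕ) (hx : x ∈ L.A T) :
    ∃ x' ∈ L.A (T ∩ U), ∀ h ∈ translateSpan (L.A U) L.F, h x = h x' := by
  obtain ⟨x', hx', h'⟩ := L.unlabel U hx
  refine ⟨x', hx', fun h hh => ?_⟩
  obtain ⟨c, rfl⟩ := mem_translateSpan_iff.1 hh
  rw [linearCombination_translate_apply, linearCombination_translate_apply]
  congr 2
  ext s
  exact h' s s.2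

/-- Definiteness of the pairing comes from unlabeling: a function in the span cannot see labels
outside `S`, so it is determined by its values on `A S`. -/
theorem exists_decomposition (S : Finset ℕ) :
    ∃ (P : Finset (N → ℝ)) (w : (N → ℝ) → ℝ),
      (∀ φ ∈ P, 0 < w φ) ∧
      (∀ φ ∈ P, φ ∈ translateSpan (L.A S) L.F ∧ IsMulOver (L.A S) φ) ∧
      (∀ φ ∈ P, ∀ ψ ∈ P, (∀ s ∈ L.A S, φ s = ψ s) → φ = ψ) ∧
      (∀ x, L.F x = ∑ φ ∈ P, w φ * φ x) ∧ P.card ≤ L.q ^ S.card := by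
  obtain ⟨P, w, h1, h2, h3, h4, h5⟩ := exists_multiplicative_decomposition (L.A S) L.F (L.fin S)
    (L.pos S) (by
      intro h hh h0
      ext x
      obtain ⟨T, hT⟩ := L.exhaust x
      obtain ⟨x', hx', h'⟩ := L.exists_unlabel S hT
      rw [h' h hh]
      exact h0 x' (L.mono Finset.inter_subset_right hx'))
  exact ⟨P, w, h1, h2, h3, h4, h5.trans (L.rank_le S)⟩

/-- The functions multiplicative over `A S` of which `F` is a positive combination. -/
noncomputable def P (S : Finset ℕ) : Finset (N → ℝ) := (L.exists_decomposition S).choose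

/-- The coefficients of `F` with respect to `P S`. -/
noncomputable def w (S : Finset ℕ) : (N → ℝ) → ℝ := (L.exists_decomposition S).choose_spec.choose

theorem w_pos (h : φ ∈ L.P S) : 0 < L.w S φ :=
  (L.exists_decomposition S).choose_spec.choose_spec.1 φ h

theorem mem_span (h : φ ∈ L.P S) : φ ∈ translateSpan (L.A S) L.F :=
  ((L.exists_decomposition S).choose_spec.choose_spec.2.1 φ h).1

theorem isMulOver (h : φ ∈ L.P S) : IsMulOver (L.A S) φ :=
  ((L.exists_decomposition S).choose_spec.choose_spec.2.1 φ h).2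

theorem isMulOver_of_subset (hST : S ⊆ T) (h : φ ∈ L.P T) : IsMulOver (L.A S) φ :=
  (L.isMulOver h).mono (L.mono hST)

theorem ext (hφ : φ ∈ L.P S) (hχ : χ ∈ L.P S) (h : ∀ s ∈ L.A S, φ s = χ s) : φ = χ :=
  (L.exists_decomposition S).choose_spec.choose_spec.2.2.1 φ hφ χ hχ h

theorem F_eq_sum (S : Finset ℕ) (x : N) : L.F x = ∑ φ ∈ L.P S, L.w S φ * φ x :=
  (L.exists_decomposition S).choose_spec.choose_spec.2.2.2.1 x

theorem card_P_le (S : Finset ℕ) : (L.P S).card ≤ L.q ^ S.card :=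
  (L.exists_decomposition S).choose_spec.choose_spec.2.2.2.2

open Classical in
/-- The elements of `P T` agreeing with `φ` on the objects with labels in `S`. -/
noncomputable def fib (S T : Finset ℕ) (φ : N → ℝ) : Finset (N → ℝ) :=
  {χ ∈ L.P T | ∀ s ∈ L.A S, χ s = φ s}

theorem mem_fib : χ ∈ L.fib S T φ ↔ χ ∈ L.P T ∧ ∀ s ∈ L.A S, χ s = φ s := by
  simp [fib]

open Classical in
theorem filter_agree_eq_singleton (hφ : φ ∈ L.P S) :
    {χ ∈ L.P S | ∀ s ∈ L.A S, χ s = φ s} = {φ} := by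
  ext χ
  simp only [Finset.mem_filter, Finset.mem_singleton]
  constructor
  · rintro ⟨h1, h2⟩
    exact L.ext h1 hφ h2
  · rintro rfl
    exact ⟨hφ, fun _ _ => rfl⟩

-- For `y ∈ A S`, expand `F (y * x)` over `P T` and over `P S`. Both are combinations of functions
-- of `y` multiplicative over `A S`, with coefficients depending on `x`; compare those of `χ`.
open Classical in
theorem sum_agree_eq (hST : S ⊆ T) (hχ : IsMulOver (L.A S) χ) (x : N) :
    ∑ ξ ∈ L.P T with ∀ s ∈ L.A S, ξ s = χ s, L.w T ξ * ξ x =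
      ∑ ψ ∈ L.P S with ∀ s ∈ L.A S, ψ s = χ s, L.w S ψ * ψ x := by
  refine sum_filter_agree_eq (L.A S) (L.P T) (L.P S) id id (fun ξ => L.w T ξ * ξ x)
    (fun ψ => L.w S ψ * ψ x) (fun i hi => L.isMulOver_of_subset hST hi)
    (fun j hj => L.isMulOver hj) (fun y hy => ?_) hχ
  trans L.F (y * x)
  · rw [L.F_eq_sum T]
    refine Finset.sum_congr rfl fun i hi => ?_
    rw [(L.isMulOver_of_subset hST hi).2 y hy, id]
    ring
  · rw [L.F_eq_sum S]
    refine Finset.sum_congr rfl fun i hi => ?_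
    rw [(L.isMulOver hi).2 y hy, id]
    ring

theorem sum_fib (hST : S ⊆ T) (hφ : φ ∈ L.P S) (x : N) :
    ∑ χ ∈ L.fib S T φ, L.w T χ * χ x = L.w S φ * φ x := by
  rw [fib, L.sum_agree_eq hST (L.isMulOver hφ), L.filter_agree_eq_singleton hφ,
    Finset.sum_singleton]

theorem eq_sum_fib (hST : S ⊆ T) (hφ : φ ∈ L.P S) (x : N) :
    φ x = ∑ χ ∈ L.fib S T φ, L.w T χ / L.w S φ * χ x := by
  have h := L.sum_fib hST hφ x
  have hne := (L.w_pos hφ).ne'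
  simp only [div_mul_eq_mul_div]
  rw [← Finset.sum_div, h]
  field_simp

/-- At `x = 1` the sum over `P T` in `sum_agree_eq` is positive, because `χ` contributes; so the sum
over `P S` cannot be empty. -/
theorem exists_agree (hST : S ⊆ T) (hχ : χ ∈ L.P T) : ∃ φ ∈ L.P S, ∀ s ∈ L.A S, χ s = φ s := by
  classical
  by_contra! hcon
  have h := L.sum_agree_eq hST (L.isMulOver_of_subset hST hχ) 1
  have h0 : {ψ ∈ L.P S | ∀ s ∈ L.A S, ψ s = χ s} = ∅ := by
    refine Finset.filter_eq_empty_iff.2 fun ψ hψ h1 => ?_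
    obtain ⟨s, hs, hne⟩ := hcon ψ hψ
    exact hne (h1 s hs).symm
  rw [h0, Finset.sum_empty] at h
  refine h.not_gt (Finset.sum_pos (fun ξ hξ => ?_) ⟨χ, by simp [hχ]⟩)
  have hξ' := (Finset.mem_filter.1 hξ).1
  rw [(L.isMulOver hξ').1, mul_one]
  exact L.w_pos hξ'

theorem translateSpan_mono {A B : Submonoid N} (h : A ≤ B) (F : N → ℝ) :
    translateSpan A F ≤ translateSpan B F := by
  refine Submodule.span_mono ?_
  rintro _ ⟨s, rfl⟩
  exact ⟨⟨s, h s.2⟩, rfl⟩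

/-- Conditional independence: an element of `P T` over `φ ∈ P S` agrees with `φ` on the objects
whose labels meet `T` only in `S`. -/
theorem agree_of_inter (hST : S ⊆ T) (hTU : T ∩ U ⊆ S) (hφ : φ ∈ L.P S)
    (hχ : χ ∈ L.fib S T φ) {y : N} (hy : y ∈ L.A U) : χ y = φ y := by
  obtain ⟨h1, h2⟩ := L.mem_fib.1 hχ
  -- Both functions lie in the span of translates by `A T`, so they only see the labels of `y` in
  -- `T`, and those are in `S`.
  obtain ⟨y', hy', h⟩ := L.exists_unlabel T hy
  rw [h χ (L.mem_span h1), h φ (translateSpan_mono (L.mono hST) L.F (L.mem_span hφ))]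
  exact h2 y' (L.mono (by rwa [Finset.inter_comm]) hy')

-- On `A U` the function `χ` coincides with `φ` by conditional independence. Expanding `χ` over `T ∪
-- U` and `φ` over `U` and comparing coefficients shows that `c` has the same conditional weight
-- given `χ` as given `φ`.
open Classical in
theorem sum_fib_agree (hST : S ⊆ T) (hSU : S ⊆ U) (hTU : T ∩ U ⊆ S) (hφ : φ ∈ L.P S)
    (hχ : χ ∈ L.fib S T φ) {c : N → ℝ} (hc : c ∈ L.fib S U φ) :
    ∑ ξ ∈ L.fib T (T ∪ U) χ with ∀ s ∈ L.A U, ξ s = c s, L.w (T ∪ U) ξ / L.w T χ =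
      L.w U c / L.w S φ := by
  have hcP := (L.mem_fib.1 hc).1
  have hχP := (L.mem_fib.1 hχ).1
  have h := sum_filter_agree_eq (L.A U) (L.fib T (T ∪ U) χ) (L.fib S U φ) id id
    (fun ξ => L.w (T ∪ U) ξ / L.w T χ) (fun c => L.w U c / L.w S φ)
    (fun i hi => L.isMulOver_of_subset Finset.subset_union_right (L.mem_fib.1 hi).1)
    (fun j hj => L.isMulOver (L.mem_fib.1 hj).1)
    (fun y hy => by
      simp only [id]
      rw [← L.eq_sum_fib Finset.subset_union_left hχP, ← L.eq_sum_fib hSU hφ,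
        L.agree_of_inter hST hTU hφ hχ hy])
    (L.isMulOver hcP)
  simp only [id] at h
  rw [h]
  have h0 : {ψ ∈ L.fib S U φ | ∀ s ∈ L.A U, ψ s = c s} = {c} := by
    ext ψ
    simp only [Finset.mem_filter, Finset.mem_singleton]
    constructor
    · rintro ⟨h1, h2⟩
      exact L.ext (L.mem_fib.1 h1).1 hcP h2
    · rintro rfl
      exact ⟨hc, fun _ _ => rfl⟩
  rw [h0, Finset.sum_singleton]

theorem exists_mem_fib_agree (hST : S ⊆ T) (hSU : S ⊆ U) (hTU : T ∩ U ⊆ S) (hφ : φ ∈ L.P S)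
    (hχ : χ ∈ L.fib S T φ) {c : N → ℝ} (hc : c ∈ L.fib S U φ) :
    ∃ ξ ∈ L.fib T (T ∪ U) χ, ∀ s ∈ L.A U, ξ s = c s := by
  classical
  by_contra! hcon
  have h := L.sum_fib_agree hST hSU hTU hφ hχ hc
  rw [Finset.filter_eq_empty_iff.2 (fun ξ hξ h1 => by
    obtain ⟨s, hs, hne⟩ := hcon ξ hξ
    exact hne (h1 s hs)), Finset.sum_empty] at h
  exact h.not_lt (div_pos (L.w_pos (L.mem_fib.1 hc).1) (L.w_pos hφ))

/-- For given `φ ∈ P S`, `χ ∈ P T` over `φ`, a choice of elements of `P (T ∪ U)` over `χ` with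
prescribed restrictions to `U`. -/
theorem exists_extension (hST : S ⊆ T) (hSU : S ⊆ U) (hTU : T ∩ U ⊆ S) (hφ : φ ∈ L.P S)
    (hχ : χ ∈ L.fib S T φ) :
    ∃ g : (N → ℝ) → (N → ℝ), Set.MapsTo g (L.fib S U φ) (L.fib T (T ∪ U) χ) ∧
      Set.InjOn g (L.fib S U φ) ∧ ∀ c ∈ L.fib S U φ, ∀ s ∈ L.A U, g c s = c s := by
  choose! g hg hg' using fun c (hc : c ∈ L.fib S U φ) =>
    L.exists_mem_fib_agree hST hSU hTU hφ hχ hc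
  refine ⟨g, hg, fun c hc d hd h => ?_, hg'⟩
  refine L.ext (L.mem_fib.1 hc).1 (L.mem_fib.1 hd).1 fun s hs => ?_
  rw [← hg' c hc s hs, ← hg' d hd s hs, h]

theorem card_fib_le (hST : S ⊆ T) (hSU : S ⊆ U) (hTU : T ∩ U ⊆ S) (hφ : φ ∈ L.P S)
    (hχ : χ ∈ L.fib S T φ) : (L.fib S U φ).card ≤ (L.fib T (T ∪ U) χ).card := by
  obtain ⟨g, h1, h2, -⟩ := L.exists_extension hST hSU hTU hφ hχ
  exact Finset.card_le_card_of_injOn g h1 h2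

open Classical in
/-- If `φ` has as many extensions to `U` as `χ` has to `T ∪ U`, then the extensions correspond
to each other bijectively, with the same relative weights. -/
theorem exists_extension_of_card_le (hST : S ⊆ T) (hSU : S ⊆ U) (hTU : T ∩ U ⊆ S)
    (hφ : φ ∈ L.P S) (hχ : χ ∈ L.fib S T φ)
    (hcard : (L.fib T (T ∪ U) χ).card ≤ (L.fib S U φ).card) :
    ∃ g : (N → ℝ) → (N → ℝ), (∀ c ∈ L.fib S U φ, g c ∈ L.fib T (T ∪ U) χ ∧
        (∀ s ∈ L.A U, g c s = c s) ∧
        ∀ ξ ∈ L.fib T (T ∪ U) χ, (∀ s ∈ L.A U, ξ s = c s) → ξ = g c) ∧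
      ∀ x, χ x = ∑ c ∈ L.fib S U φ, L.w U c / L.w S φ * g c x := by
  obtain ⟨g, h1, h2, h3⟩ := L.exists_extension hST hSU hTU hφ hχ
  -- An injection into a set that is no larger is onto, so every extension of `χ` is determined by
  -- its restriction to `U`.
  have himage : (L.fib S U φ).image g = L.fib T (T ∪ U) χ := by
    refine Finset.eq_of_subset_of_card_le (Finset.image_subset_iff.2 h1) ?_
    rwa [Finset.card_image_of_injOn h2]
  have huniq : ∀ c ∈ L.fib S U φ, ∀ ξ ∈ L.fib T (T ∪ U) χ, (∀ s ∈ L.A U, ξ s = c s) →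
      ξ = g c := by
    intro c hc ξ hξ h
    obtain ⟨d, hd, rfl⟩ := Finset.mem_image.1 (himage ▸ hξ)
    congr 1
    refine L.ext (L.mem_fib.1 hd).1 (L.mem_fib.1 hc).1 fun s hs => ?_
    rw [← h3 d hd s hs, h s hs]
  refine ⟨g, fun c hc => ⟨h1 hc, h3 c hc, huniq c hc⟩, fun x => ?_⟩
  rw [L.eq_sum_fib Finset.subset_union_left (L.mem_fib.1 hχ).1, ← himage, Finset.sum_image h2]
  refine Finset.sum_congr rfl fun c hc => ?_
  congr 1
  rw [← L.sum_fib_agree hST hSU hTU hφ hχ hc]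
  have h0 : {ξ ∈ L.fib T (T ∪ U) χ | ∀ s ∈ L.A U, ξ s = c s} = {g c} := by
    ext ξ
    simp only [Finset.mem_filter, Finset.mem_singleton]
    constructor
    · rintro ⟨h4, h5⟩
      exact huniq c hc ξ h4 h5
    · rintro rfl
      exact ⟨h1 hc, h3 c hc⟩
  rw [h0, Finset.sum_singleton]

/-! ### Invariance under relabeling -/

theorem act_inv_act (σ : Equiv.Perm ℕ) (x : N) : L.act σ (L.act σ⁻¹ x) = x := by
  rw [← L.act_mul, mul_inv_cancel, L.act_one]

theorem act_of_fix {x : N} {σ : Equiv.Perm ℕ} (hx : x ∈ L.A S) (hσ : ∀ i ∈ S, σ i = i) :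
    L.act σ x = x :=
  (L.act_congr (τ := 1) hx (by simpa using hσ)).trans (L.act_one x)

theorem act_inv_mem (σ : Equiv.Perm ℕ) {x : N} (hx : x ∈ L.A (S.image σ)) :
    L.act σ⁻¹ x ∈ L.A S := by
  have h := L.act_mem σ⁻¹ hx
  rwa [Finset.image_image, Finset.image_congr (g := id) (fun i _ => by simp), Finset.image_id] at h

/-- As `F` is invariant, composing its decomposition over `S.image σ` with `σ` gives a decomposition
over `S`; by uniqueness it has the same terms and weights as the chosen one. -/
theorem comp_act_mem (σ : Equiv.Perm ℕ) (hφ : φ ∈ L.P (S.image σ)) :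
    φ ∘ L.act σ ∈ L.P S ∧ L.w S (φ ∘ L.act σ) = L.w (S.image σ) φ := by
  classical
  have hmul : ∀ ψ ∈ L.P (S.image σ), IsMulOver (L.A S) (ψ ∘ L.act σ) := by
    intro ψ hψ
    refine ⟨by simp [(L.isMulOver hψ).1], fun s hs x => ?_⟩
    simp only [Function.comp_apply, map_mul]
    exact (L.isMulOver hψ).2 _ (L.act_mem σ hs) _
  have key : ∀ x, L.w (S.image σ) φ * φ (L.act σ x) =
      ∑ ψ ∈ L.P S with ∀ s ∈ L.A S, ψ s = (φ ∘ L.act σ) s, L.w S ψ * ψ x := by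
    intro x
    have h := sum_filter_agree_eq (L.A S) (L.P (S.image σ)) (L.P S) (fun ψ => ψ ∘ L.act σ) id
      (fun ψ => L.w (S.image σ) ψ * ψ (L.act σ x)) (fun ψ => L.w S ψ * ψ x)
      hmul (fun j hj => L.isMulOver hj) (fun y hy => ?_) (hmul φ hφ)
    · simp only [id] at h
      rw [← h]
      have h0 : {ψ ∈ L.P (S.image σ) | ∀ s ∈ L.A S, (ψ ∘ L.act σ) s = (φ ∘ L.act σ) s} = {φ} := by
        ext ψ
        simp only [Finset.mem_filter, Finset.mem_singleton]
        constructor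
        · rintro ⟨h1, h2⟩
          refine L.ext h1 hφ fun s hs => ?_
          have := h2 _ (L.act_inv_mem σ hs)
          simpa only [Function.comp_apply, act_inv_act] using this
        · rintro rfl
          exact ⟨hφ, fun _ _ => rfl⟩
      rw [h0, Finset.sum_singleton]
    · trans L.F (y * x)
      · rw [← L.F_act σ, map_mul, L.F_eq_sum (S.image σ)]
        refine Finset.sum_congr rfl fun i hi => ?_
        rw [(L.isMulOver hi).2 _ (L.act_mem σ hy), Function.comp_apply]
        ring
      · rw [L.F_eq_sum S]
        refine Finset.sum_congr rfl fun i hi => ?_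
        rw [(L.isMulOver hi).2 y hy, id]
        ring
  have hw := L.w_pos hφ
  obtain ⟨ψ, hψ, hagree⟩ : ∃ ψ ∈ L.P S, ∀ s ∈ L.A S, ψ s = (φ ∘ L.act σ) s := by
    by_contra! hcon
    have h := key 1
    rw [Finset.filter_eq_empty_iff.2 (fun ξ hξ h1 => by
      obtain ⟨s, hs, hne⟩ := hcon ξ hξ
      exact hne (h1 s hs)), Finset.sum_empty, map_one, (L.isMulOver hφ).1] at h
    linarith
  have h1 : ∀ x, L.w (S.image σ) φ * φ (L.act σ x) = L.w S ψ * ψ x := by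
    intro x
    rw [key x]
    have h0 : {ξ ∈ L.P S | ∀ s ∈ L.A S, ξ s = (φ ∘ L.act σ) s} = {ψ} := by
      ext ξ
      simp only [Finset.mem_filter, Finset.mem_singleton]
      constructor
      · rintro ⟨h1, h2⟩
        exact L.ext h1 hψ fun s hs => (h2 s hs).trans (hagree s hs).symm
      · rintro rfl
        exact ⟨hψ, hagree⟩
    rw [h0, Finset.sum_singleton]
  have h2 : L.w (S.image σ) φ = L.w S ψ := by
    simpa [(L.isMulOver hφ).1, (L.isMulOver hψ).1] using h1 1
  have h3 : φ ∘ L.act σ = ψ := by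
    ext x
    have := h1 x
    rw [h2] at this
    exact mul_left_cancel₀ (L.w_pos hψ).ne' this
  rw [h3]
  exact ⟨hψ, h2.symm⟩

theorem comp_act_mem_fib {σ : Equiv.Perm ℕ} (hσ : ∀ i ∈ S, σ i = i)
    (hχ : χ ∈ L.fib S (T.image σ) φ) :
    χ ∘ L.act σ ∈ L.fib S T φ ∧ L.w T (χ ∘ L.act σ) = L.w (T.image σ) χ := by
  obtain ⟨h1, h2⟩ := L.mem_fib.1 hχ
  obtain ⟨h3, h4⟩ := L.comp_act_mem σ h1
  refine ⟨L.mem_fib.2 ⟨h3, fun s hs => ?_⟩, h4⟩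
  rw [Function.comp_apply, L.act_of_fix hs hσ, h2 s hs]

theorem comp_act_injective (σ : Equiv.Perm ℕ) :
    Function.Injective fun χ : N → ℝ => χ ∘ L.act σ := by
  intro χ ξ h
  ext x
  have := congrFun h (L.act σ⁻¹ x)
  simpa only [Function.comp_apply, act_inv_act] using this

theorem image_swap_insert {S : Finset ℕ} {u v : ℕ} (hu : u ∉ S) (hv : v ∉ S) :
    (insert v S).image (Equiv.swap u v) = insert u S := by
  rw [Finset.image_insert, Equiv.swap_apply_right]
  congr 1
  refine (Finset.image_congr (g := id) fun _ hi => ?_).trans Finset.image_id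
  exact Equiv.swap_apply_of_ne_of_ne (fun h => hu (h ▸ hi)) (fun h => hv (h ▸ hi))

theorem swap_fix {S : Finset ℕ} {u v : ℕ} (hu : u ∉ S) (hv : v ∉ S) :
    ∀ i ∈ S, Equiv.swap u v i = i := fun _ hi =>
  Equiv.swap_apply_of_ne_of_ne (fun h => hu (h ▸ hi)) (fun h => hv (h ▸ hi))

theorem comp_swap_mem_fib {u v : ℕ} (hu : u ∉ S) (hv : v ∉ S) (hχ : χ ∈ L.fib S (insert u S) φ) :
    χ ∘ L.act (Equiv.swap u v) ∈ L.fib S (insert v S) φ ∧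
      L.w (insert v S) (χ ∘ L.act (Equiv.swap u v)) = L.w (insert u S) χ := by
  rw [← image_swap_insert hu hv] at hχ ⊢
  exact L.comp_act_mem_fib (swap_fix hu hv) hχ

theorem card_fib_insert_le {u v : ℕ} (hu : u ∉ S) (hv : v ∉ S) :
    (L.fib S (insert u S) φ).card ≤ (L.fib S (insert v S) φ).card :=
  Finset.card_le_card_of_injOn _ (fun _ hχ => (L.comp_swap_mem_fib hu hv hχ).1)
    (L.comp_act_injective _).injOn

/-! ### Counting one-label extensions -/

theorem inter_insert_subset {S T : Finset ℕ} {v : ℕ} (hv : v ∉ T) : T ∩ insert v S ⊆ S := by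
  intro i hi
  rw [Finset.mem_inter, Finset.mem_insert] at hi
  rcases hi.2 with rfl | h
  · exact absurd hi.1 hv
  · exact h

theorem union_insert_eq {S T : Finset ℕ} (hST : S ⊆ T) (v : ℕ) :
    T ∪ insert v S = insert v T := by
  rw [Finset.union_insert, Finset.union_eq_left.2 hST]

theorem card_fib_insert_mono (hST : S ⊆ T) {u v : ℕ} (hu : u ∉ S) (hv : v ∉ T) (hφ : φ ∈ L.P S)
    (hχ : χ ∈ L.fib S T φ) :
    (L.fib S (insert u S) φ).card ≤ (L.fib T (insert v T) χ).card := by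
  have hvS : v ∉ S := fun h => hv (hST h)
  refine (L.card_fib_insert_le hu hvS).trans ?_
  rw [← union_insert_eq hST v]
  exact L.card_fib_le hST (Finset.subset_insert v S) (inter_insert_subset hv) hφ hχ

/-- Each fresh label multiplies the number of extensions at least by the number available at `φ`,
since extensions of distinct elements are distinct. -/
theorem exists_pow_le_card_fib {v : ℕ} (hv : v ∉ S) (hφ : φ ∈ L.P S) (m : ℕ) :
    ∃ T, S ⊆ T ∧ T.card = S.card + m ∧
      (L.fib S (insert v S) φ).card ^ m ≤ (L.fib S T φ).card := by
  classical
  induction m with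
  | zero => exact ⟨S, Finset.Subset.refl S, rfl, by
      simpa using Finset.card_pos.2 ⟨φ, L.mem_fib.2 ⟨hφ, fun _ _ => rfl⟩⟩⟩
  | succ m ih =>
    obtain ⟨T, hST, hcard, hle⟩ := ih
    obtain ⟨u, hu⟩ := Infinite.exists_notMem_finset T
    refine ⟨insert u T, hST.trans (Finset.subset_insert u T), ?_, ?_⟩
    · rw [Finset.card_insert_of_notMem hu, hcard, add_assoc]
    · have hsub : (L.fib S T φ).biUnion (fun χ => L.fib T (insert u T) χ) ⊆
          L.fib S (insert u T) φ := by
        intro ξ hξ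
        obtain ⟨χ, hχ, hξ⟩ := Finset.mem_biUnion.1 hξ
        refine L.mem_fib.2 ⟨(L.mem_fib.1 hξ).1, fun s hs => ?_⟩
        rw [(L.mem_fib.1 hξ).2 s (L.mono hST hs), (L.mem_fib.1 hχ).2 s hs]
      refine le_trans ?_ (Finset.card_le_card hsub)
      rw [Finset.card_biUnion]
      · calc _ ≤ (L.fib S T φ).card * (L.fib S (insert v S) φ).card := by
              rw [pow_succ]
              exact Nat.mul_le_mul_right _ hle
          _ = ∑ χ ∈ L.fib S T φ, (L.fib S (insert v S) φ).card := by simp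
          _ ≤ _ := Finset.sum_le_sum fun χ hχ => L.card_fib_insert_mono hST hv hu hφ hχ
      · intro χ hχ ψ hψ hne
        refine Finset.disjoint_left.2 fun ξ h1 h2 => hne ?_
        refine L.ext (L.mem_fib.1 hχ).1 (L.mem_fib.1 hψ).1 fun s hs => ?_
        rw [← (L.mem_fib.1 h1).2 s hs, (L.mem_fib.1 h2).2 s hs]

/-- With `D` one-label extensions, `D ^ m ≤ q ^ (|S| + m)` for all `m`, which is impossible for `D >
q`. -/
theorem card_fib_insert_le_q {v : ℕ} (hv : v ∉ S) (hφ : φ ∈ L.P S) :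
    (L.fib S (insert v S) φ).card ≤ L.q := by
  by_contra! hlt
  have hq : (0 : ℝ) < L.q := by exact_mod_cast L.q_pos
  set D := (L.fib S (insert v S) φ).card
  obtain ⟨m, hm⟩ := pow_unbounded_of_one_lt ((L.q : ℝ) ^ S.card)
    (show 1 < (D : ℝ) / L.q by rw [one_lt_div hq]; exact_mod_cast hlt)
  obtain ⟨T, -, hcard, hle⟩ := L.exists_pow_le_card_fib hv hφ m
  have h1 : D ^ m ≤ L.q ^ (S.card + m) := by
    rw [← hcard]
    exact hle.trans ((Finset.card_le_card fun χ hχ => (L.mem_fib.1 hχ).1).trans (L.card_P_le T))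
  have h2 : (D : ℝ) ^ m ≤ (L.q : ℝ) ^ S.card * (L.q : ℝ) ^ m := by
    rw [← pow_add]
    exact_mod_cast h1
  rw [div_pow, lt_div_iff₀ (by positivity)] at hm
  linarith

theorem P_nonempty (S : Finset ℕ) : (L.P S).Nonempty := by
  by_contra h
  have := L.F_eq_sum S 1
  rw [Finset.not_nonempty_iff_eq_empty.1 h, Finset.sum_empty, L.F_one] at this
  exact one_ne_zero this

/-- There is a `φ` with the maximum number of one-label extensions. -/
theorem exists_maximal : ∃ S, ∃ φ ∈ L.P S, ∀ u ∉ S, ∀ T, S ⊆ T → ∀ v ∉ T, ∀ χ ∈ L.fib S T φ,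
    (L.fib T (insert v T) χ).card ≤ (L.fib S (insert u S) φ).card := by
  let D : Set ℕ := {d | ∃ S, ∃ φ ∈ L.P S, ∃ v ∉ S, d = (L.fib S (insert v S) φ).card}
  have hne : D.Nonempty := by
    obtain ⟨φ, hφ⟩ := L.P_nonempty ∅
    exact ⟨_, ∅, φ, hφ, 0, by simp, rfl⟩
  have hbdd : BddAbove D := by
    refine ⟨L.q, ?_⟩
    rintro _ ⟨S, φ, hφ, v, hv, rfl⟩
    exact L.card_fib_insert_le_q hv hφ
  obtain ⟨S, φ, hφ, v, hv, hd⟩ := Nat.sSup_mem hne hbdd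
  refine ⟨S, φ, hφ, fun u hu T _ v' hv' χ hχ => ?_⟩
  refine le_trans (le_csSup hbdd ⟨T, χ, (L.mem_fib.1 hχ).1, v', hv', rfl⟩) ?_
  rw [hd]
  exact L.card_fib_insert_le hv hu

/-- The bound `q ^ 0 = 1` leaves a single element in the decomposition over no labels, and `F 1 = 1`
gives it weight one. -/
theorem F_mem_P_empty : L.F ∈ L.P ∅ := by
  obtain ⟨φ, hφ⟩ := L.P_nonempty ∅
  have h1 : L.P ∅ = {φ} := by
    refine (Finset.eq_of_subset_of_card_le (Finset.singleton_subset_iff.2 hφ) ?_).symm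
    simpa using L.card_P_le ∅
  have h2 : ∀ x, L.F x = L.w ∅ φ * φ x := by
    intro x
    rw [L.F_eq_sum ∅, h1, Finset.sum_singleton]
  have h3 : L.w ∅ φ = 1 := by
    have := h2 1
    rw [L.F_one, (L.isMulOver hφ).1, mul_one] at this
    exact this.symm
  have h4 : L.F = φ := by
    ext x
    rw [h2, h3, one_mul]
  rwa [h4]

/-- Conditional independence over the empty label set, where every `φ` extends `F`. -/
theorem eq_F_of_disjoint (hφ : φ ∈ L.P S) (hSU : Disjoint S U) {x : N} (hx : x ∈ L.A U) :
    φ x = L.F x := by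
  refine L.agree_of_inter (Finset.empty_subset S) (Finset.disjoint_iff_inter_eq_empty.1 hSU).le
    L.F_mem_P_empty ?_ hx
  obtain ⟨ψ, hψ, h⟩ := L.exists_agree (Finset.empty_subset S) hφ
  have : ψ = L.F := by
    have h1 := Finset.card_le_one.1 ((L.card_P_le ∅).trans (by simp))
    exact h1 ψ hψ L.F L.F_mem_P_empty
  exact L.mem_fib.2 ⟨hφ, this ▸ h⟩

end LabelSystem

/-! ### Rigidity above a maximal element -/

namespace LabelSystem

variable {N : Type*} [CommMonoid N] (L : LabelSystem N) {S T U : Finset ℕ} {φ χ ξ : N → ℝ}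

/-- `φ` has the maximum number of one-label extensions. -/
def IsMaximal (S : Finset ℕ) (φ : N → ℝ) : Prop :=
  φ ∈ L.P S ∧ ∀ u ∉ S, ∀ T, S ⊆ T → ∀ v ∉ T, ∀ χ ∈ L.fib S T φ,
    (L.fib T (insert v T) χ).card ≤ (L.fib S (insert u S) φ).card

variable {L}

/-- Above a maximal element, one-label extensions over larger label sets are the one-label
extensions of that element. -/
theorem IsMaximal.exists_extension (h : L.IsMaximal S φ) (hST : S ⊆ T) {u v : ℕ} (hu : u ∉ S)
    (hv : v ∉ T) (hχ : χ ∈ L.fib S T φ) :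
    ∃ g : (N → ℝ) → (N → ℝ), (∀ c ∈ L.fib S (insert u S) φ, g c ∈ L.fib T (insert v T) χ ∧
        (∀ s ∈ L.A (insert v S), g c s = c (L.act (Equiv.swap u v) s)) ∧
        ∀ ξ ∈ L.fib T (insert v T) χ,
          (∀ s ∈ L.A (insert v S), ξ s = c (L.act (Equiv.swap u v) s)) → ξ = g c) ∧
      ∀ x, χ x = ∑ c ∈ L.fib S (insert u S) φ, L.w (insert u S) c / L.w S φ * g c x := by
  have hvS : v ∉ S := fun h => hv (hST h)
  obtain ⟨g, h1, h2⟩ := L.exists_extension_of_card_le hST (Finset.subset_insert v S)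
    (inter_insert_subset hv) h.1 hχ
    (by rw [union_insert_eq hST]; exact h.2 v hvS T hST v hv χ hχ)
  rw [union_insert_eq hST] at h1
  -- Extensions by `v` are indexed by extensions by the reference label `u`, so that all fresh
  -- labels share one index set, the future node set of `H`.
  refine ⟨fun c => g (c ∘ L.act (Equiv.swap u v)), fun c hc =>
    h1 _ (L.comp_swap_mem_fib hu hvS hc).1, fun x => ?_⟩
  rw [h2]
  symm
  refine Finset.sum_bij (fun c _ => c ∘ L.act (Equiv.swap u v))
    (fun c hc => (L.comp_swap_mem_fib hu hvS hc).1)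
    (fun c _ d _ hcd => L.comp_act_injective _ hcd) (fun c hc => ?_) (fun c hc => ?_)
  · refine ⟨c ∘ L.act (Equiv.swap v u), (L.comp_swap_mem_fib hvS hu hc).1, ?_⟩
    ext x
    rw [Function.comp_apply, Function.comp_apply, ← L.act_mul, Equiv.swap_comm v u,
      Equiv.swap_mul_self, L.act_one]
  · rw [(L.comp_swap_mem_fib hu hvS hc).2]

/-- Maximality makes restriction to `insert v S` a bijection from the extensions of `χ` by `v` to
those of `φ`. -/
theorem IsMaximal.eq_of_agree (h : L.IsMaximal S φ) (hST : S ⊆ T) {v : ℕ} (hv : v ∉ T)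
    (hχ : χ ∈ L.fib S T φ) {ξ η : N → ℝ} (hξ : ξ ∈ L.fib T (insert v T) χ)
    (hη : η ∈ L.fib T (insert v T) χ) (hagree : ∀ s ∈ L.A (insert v S), ξ s = η s) : ξ = η := by
  have hvS : v ∉ S := fun h => hv (hST h)
  obtain ⟨g, h1, -⟩ := h.exists_extension hST hvS hv hχ
  obtain ⟨c, hc, hcη⟩ := L.exists_agree (Finset.insert_subset_insert v hST) (L.mem_fib.1 hη).1
  have hc' : c ∈ L.fib S (insert v S) φ := by
    refine L.mem_fib.2 ⟨hc, fun s hs => ?_⟩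
    rw [← hcη s (L.mono (Finset.subset_insert v S) hs), (L.mem_fib.1 hη).2 s (L.mono hST hs),
      (L.mem_fib.1 hχ).2 s hs]
  have h2 : ∀ s ∈ L.A (insert v S), η s = c (L.act (Equiv.swap v v) s) := by
    intro s hs
    rw [Equiv.swap_self, ← Equiv.Perm.one_def, L.act_one, hcη s hs]
  rw [(h1 c hc').2.2 η hη h2, (h1 c hc').2.2 ξ hξ fun s hs => (hagree s hs).trans (h2 s hs)]

/-- An element over `φ` with two extra labels is determined by its restrictions to the sets with
one extra label. -/
theorem IsMaximal.eq_of_agree_pair (h : L.IsMaximal S φ) {u v : ℕ}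
    (hv : v ∉ insert u S) {ξ η : N → ℝ} (hξ : ξ ∈ L.P (insert v (insert u S)))
    (hη : η ∈ L.P (insert v (insert u S))) (hφ : ∀ s ∈ L.A S, η s = φ s)
    (h1 : ∀ s ∈ L.A (insert u S), ξ s = η s) (h2 : ∀ s ∈ L.A (insert v S), ξ s = η s) :
    ξ = η := by
  obtain ⟨c, hc, hcη⟩ := L.exists_agree (Finset.subset_insert v (insert u S)) hη
  have hc' : c ∈ L.fib S (insert u S) φ := by
    refine L.mem_fib.2 ⟨hc, fun s hs => ?_⟩
    rw [← hcη s (L.mono (Finset.subset_insert u S) hs), hφ s hs]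
  exact h.eq_of_agree (Finset.subset_insert u S) hv hc' (L.mem_fib.2 ⟨hξ, fun s hs =>
    (h1 s hs).trans (hcη s hs)⟩) (L.mem_fib.2 ⟨hη, hcη⟩) h2

/-- The extension of `φ` to two labels with prescribed restrictions. -/
theorem IsMaximal.exists_pair (h : L.IsMaximal S φ) {u v : ℕ} (hu : u ∉ S)
    (hv : v ∉ insert u S) (c d : L.fib S (insert u S) φ) :
    ∃ ξ ∈ L.P (insert v (insert u S)), (∀ s ∈ L.A (insert u S), ξ s = c.1 s) ∧
      ∀ s ∈ L.A (insert v S), ξ s = d.1 (L.act (Equiv.swap u v) s) := by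
  obtain ⟨g, h1, -⟩ := h.exists_extension (Finset.subset_insert u S) hu hv c.2
  obtain ⟨h2, h3, -⟩ := h1 d d.2
  exact ⟨g d, (L.mem_fib.1 h2).1, (L.mem_fib.1 h2).2, h3⟩

/-- The extension of `φ` to two labels with prescribed restrictions. -/
noncomputable def IsMaximal.pair (h : L.IsMaximal S φ) {u v : ℕ} (hu : u ∉ S)
    (hv : v ∉ insert u S) (c d : L.fib S (insert u S) φ) : N → ℝ :=
  (h.exists_pair hu hv c d).choose

theorem IsMaximal.pair_spec (h : L.IsMaximal S φ) {u v : ℕ} (hu : u ∉ S)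
    (hv : v ∉ insert u S) (c d : L.fib S (insert u S) φ) :
    h.pair hu hv c d ∈ L.P (insert v (insert u S)) ∧
      (∀ s ∈ L.A (insert u S), h.pair hu hv c d s = c.1 s) ∧
      ∀ s ∈ L.A (insert v S), h.pair hu hv c d s = d.1 (L.act (Equiv.swap u v) s) :=
  (h.exists_pair hu hv c d).choose_spec

/-- Values on objects with two extra labels `σ u`, `σ v` only depend on the restrictions to
these labels. -/
theorem IsMaximal.eq_pair (h : L.IsMaximal S φ) {u v : ℕ} (hu : u ∉ S)
    (hv : v ∉ insert u S) (c d : L.fib S (insert u S) φ) {σ : Equiv.Perm ℕ}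
    (hσ : ∀ i ∈ S, σ i = i) (hξ : ξ ∈ L.P T) (hT : (insert v (insert u S)).image σ ⊆ T)
    (h1 : ∀ s ∈ L.A (insert (σ u) S), ξ s = c.1 (L.act (Equiv.swap u (σ u)) s))
    (h2 : ∀ s ∈ L.A (insert (σ v) S), ξ s = d.1 (L.act (Equiv.swap u (σ v)) s))
    {x : N} (hx : x ∈ L.A (insert v (insert u S))) : ξ (L.act σ x) = h.pair hu hv c d x := by
  have hfixS : ∀ i, i ∉ S → σ i ∉ S := fun i hi hs => hi (by
    have := hσ _ hs
    rw [σ.injective this] at hs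
    exact hs)
  have huS := hfixS u hu
  have hv' : v ∉ S := fun hs => hv (Finset.mem_insert_of_mem hs)
  have hvS := hfixS v hv'
  have huv : u ≠ v := fun e => hv (e ▸ Finset.mem_insert_self _ _)
  have himg : S.image σ = S := (Finset.image_congr (g := id) fun i hi => hσ i hi).trans
    Finset.image_id
  obtain ⟨η, hη, hηξ⟩ := L.exists_agree hT hξ
  obtain ⟨hp, hp1, hp2⟩ := h.pair_spec hu hv c d
  rw [hηξ _ (L.act_mem σ hx)]
  change (η ∘ L.act σ) x = _
  -- Pulled back along `σ`, the restriction of `ξ` has the same one-label restrictions as the pair,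
  -- so it is the pair.
  have e1 : ∀ s ∈ L.A (insert u S), (η ∘ L.act σ) s = h.pair hu hv c d s := by
    intro s hs
    have hs' := L.act_mem σ hs
    rw [hp1 s hs, Function.comp_apply,
      ← hηξ _ (L.mono (Finset.image_subset_image (Finset.subset_insert _ _)) hs')]
    rw [Finset.image_insert, himg] at hs'
    rw [h1 _ hs', ← L.act_mul, L.act_of_fix hs]
    intro i hi
    rw [Equiv.Perm.mul_apply]
    rcases Finset.mem_insert.1 hi with rfl | hi
    · simp
    · rw [hσ i hi, swap_fix hu huS i hi]
  have e2 : ∀ s ∈ L.A (insert v S), (η ∘ L.act σ) s = h.pair hu hv c d s := by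
    intro s hs
    have hs' := L.act_mem σ hs
    rw [hp2 s hs, Function.comp_apply, ← hηξ _ (L.mono (Finset.image_subset_image
      (Finset.insert_subset_insert _ (Finset.subset_insert _ _))) hs')]
    rw [Finset.image_insert, himg] at hs'
    rw [h2 _ hs', ← L.act_mul]
    refine congrArg d.1 (L.act_congr hs ?_)
    intro i hi
    rw [Equiv.Perm.mul_apply]
    rcases Finset.mem_insert.1 hi with rfl | hi
    · simp
    · rw [hσ i hi, swap_fix hu hvS i hi, swap_fix hu hv' i hi]
  refine congrFun (h.eq_of_agree_pair hv (L.comp_act_mem σ hη).1 hp (fun s hs => ?_) e1 e2) x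
  rw [hp1 s (L.mono (Finset.subset_insert _ _) hs)]
  exact (L.mem_fib.1 c.2).2 s hs

/-- Exchanging the labels exchanges the prescribed restrictions. This yields the symmetry of the
edge weights. -/
theorem IsMaximal.pair_swap (h : L.IsMaximal S φ) {u v : ℕ} (hu : u ∉ S)
    (hv : v ∉ insert u S) (c d : L.fib S (insert u S) φ) {x : N}
    (hx : x ∈ L.A (insert v (insert u S))) (hxs : L.act (Equiv.swap u v) x = x) :
    h.pair hu hv c d x = h.pair hu hv d c x := by
  have hv' : v ∉ S := fun hs => hv (Finset.mem_insert_of_mem hs)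
  obtain ⟨hp, hp1, hp2⟩ := h.pair_spec hu hv c d
  rw [← h.eq_pair hu hv d c (swap_fix hu hv') hp ?_ ?_ ?_ hx, hxs]
  · rw [Finset.image_insert, Finset.image_insert, Equiv.swap_apply_right, Equiv.swap_apply_left,
      (Finset.image_congr (g := id) fun i hi => swap_fix hu hv' i hi).trans Finset.image_id,
      Finset.insert_comm]
  · rw [Equiv.swap_apply_left]
    exact hp2
  · rw [Equiv.swap_apply_right]
    intro s hs
    rw [hp1 s hs, Equiv.swap_self, ← Equiv.Perm.one_def, L.act_one]

/-! ### Many fresh labels and the weighted graph -/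

/-- The label set `S` together with the first `n` labels from `p` on. -/
def extend (S : Finset ℕ) (p n : ℕ) : Finset ℕ := S ∪ (Finset.range n).image (p + ·)

theorem extend_succ (S : Finset ℕ) (p n : ℕ) :
    extend S p (n + 1) = insert (p + n) (extend S p n) := by
  simp [extend, Finset.range_add_one, Finset.image_insert]

theorem subset_extend (S : Finset ℕ) (p n : ℕ) : S ⊆ extend S p n := Finset.subset_union_left

theorem add_mem_extend (S : Finset ℕ) (p : ℕ) {n i : ℕ} (hi : i < n) : p + i ∈ extend S p n :=
  Finset.mem_union_right _ (Finset.mem_image_of_mem _ (Finset.mem_range.2 hi))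

theorem add_notMem_extend {S : Finset ℕ} {p : ℕ} (hp : ∀ i ∈ S, i < p) (n : ℕ) :
    p + n ∉ extend S p n := by
  intro h
  rcases Finset.mem_union.1 h with h | h
  · exact absurd (hp _ h) (by omega)
  · obtain ⟨i, hi, h⟩ := Finset.mem_image.1 h
    have := Finset.mem_range.1 hi
    omega

/-- Over `n` fresh labels, a maximal `φ` is a combination of extensions indexed by the assignments
of one-label extensions to the labels. -/
theorem IsMaximal.exists_family (h : L.IsMaximal S φ) {u p : ℕ} (hu : u ∉ S)
    (hp : ∀ i ∈ S, i < p) (n : ℕ) :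
    ∃ Ξ : (Fin n → L.fib S (insert u S) φ) → N → ℝ,
      (∀ k, Ξ k ∈ L.fib S (extend S p n) φ ∧ ∀ i : Fin n, ∀ s ∈ L.A (insert (p + i) S),
        Ξ k s = (k i).1 (L.act (Equiv.swap u (p + i)) s)) ∧
      ∀ x, φ x = ∑ k, (∏ i, L.w (insert u S) (k i) / L.w S φ) * Ξ k x := by
  induction n with
  | zero =>
    refine ⟨fun _ => φ, fun k => ⟨L.mem_fib.2 ⟨by simpa [extend] using h.1, fun _ _ => rfl⟩,
      fun i => i.elim0⟩, fun x => by simp⟩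
  | succ n ih =>
    obtain ⟨Ξ, h1, h2⟩ := ih
    choose g hg hsum using fun k =>
      h.exists_extension (subset_extend S p n) hu (add_notMem_extend hp n) (h1 k).1
    rw [← extend_succ] at hg
    refine ⟨fun k => g (Fin.init k) (k (Fin.last n)), fun k => ?_, fun x => ?_⟩
    · obtain ⟨h3, h4, -⟩ := hg (Fin.init k) (k (Fin.last n)) (k (Fin.last n)).2
      have h5 := L.mem_fib.1 h3
      refine ⟨L.mem_fib.2 ⟨h5.1, fun s hs => ?_⟩, fun i => ?_⟩
      · beta_reduce
        rw [h5.2 s (L.mono (subset_extend S p n) hs), (L.mem_fib.1 (h1 _).1).2 s hs]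
      · refine Fin.lastCases ?_ (fun j => ?_) i
        · exact h4
        · intro s hs
          beta_reduce
          rw [h5.2 s (L.mono (Finset.insert_subset (add_mem_extend S p j.2)
            (subset_extend S p n)) hs)]
          exact (h1 (Fin.init k)).2 j s hs
    · rw [h2 x]
      simp only [Fin.prod_univ_castSucc]
      rw [← (Fin.snocEquiv fun _ : Fin (n + 1) => L.fib S (insert u S) φ).sum_comp,
        Fintype.sum_prod_type_right]
      refine Finset.sum_congr rfl fun k _ => ?_
      rw [hsum k x, Finset.mul_sum, ← Finset.sum_coe_sort]
      refine Finset.sum_congr rfl fun c _ => ?_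
      simp [Fin.snocEquiv, mul_assoc]

/-- The invariant of a label system with edges is given by a weighted graph. -/
theorem exists_weights (L : LabelSystem N) (e : ℕ → ℕ → N) (he : ∀ i j, e i j ∈ L.A {i, j})
    (hsymm : ∀ i j, e i j = e j i) (hact : ∀ σ i j, L.act σ (e i j) = e (σ i) (σ j)) :
    ∃ (d : ℕ) (α : Fin d → ℝ) (β : Matrix (Fin d) (Fin d) ℝ) (p : ℕ),
      (∀ i, 0 < α i) ∧ β.IsSymm ∧ ∀ (n : ℕ) (E : Multiset (Fin n × Fin n)),
        (∀ z ∈ E, z.1 ≠ z.2) →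
        L.F (E.map fun z => e (p + z.1) (p + z.2)).prod =
          ∑ k : Fin n → Fin d, (∏ i, α (k i)) * (E.map fun z => β (k z.1) (k z.2)).prod := by
  obtain ⟨S, φ, hφ, hmax⟩ := L.exists_maximal
  have h : L.IsMaximal S φ := ⟨hφ, hmax⟩
  -- Labels `u` and `u + 1` are references used to define the weights; the nodes of a graph get
  -- labels from `u + 2` on, clear of these and of `S`.
  obtain ⟨u, hu⟩ : ∃ u, ∀ i ∈ S, i < u := ⟨S.sup id + 1, fun i hi =>
    Nat.lt_succ_of_le (Finset.le_sup (f := id) hi)⟩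
  have huS : u ∉ S := fun hs => (hu u hs).false
  have hvS : u + 1 ∉ S := fun hs => absurd (hu _ hs) (by omega)
  have hv : u + 1 ∉ insert u S := by simp [hvS]
  have hp : ∀ i ∈ S, i < u + 2 := fun i hi => (hu i hi).trans (by omega)
  have hemem : e u (u + 1) ∈ L.A (insert (u + 1) (insert u S)) :=
    L.mono (by intro i; simp; tauto) (he u (u + 1))
  let ε := Fintype.equivFin (L.fib S (insert u S) φ)
  let B : L.fib S (insert u S) φ → L.fib S (insert u S) φ → ℝ :=
    fun c d => h.pair huS hv c d (e u (u + 1))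
  refine ⟨_, fun i => L.w (insert u S) (ε.symm i) / L.w S φ,
    Matrix.of fun i j => B (ε.symm i) (ε.symm j), u + 2, fun i => ?_, ?_, fun n E hE => ?_⟩
  · exact div_pos (L.w_pos (L.mem_fib.1 (ε.symm i).2).1) (L.w_pos hφ)
  · ext i j
    refine h.pair_swap huS hv _ _ hemem ?_
    rw [hact, Equiv.swap_apply_left, Equiv.swap_apply_right, hsymm]
  · obtain ⟨Ξ, h1, h2⟩ := h.exists_family huS hp n
    have hdisj : Disjoint S ((Finset.range n).image (u + 2 + ·)) := by
      refine Finset.disjoint_left.2 fun i hi hi' => ?_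
      obtain ⟨j, -, rfl⟩ := Finset.mem_image.1 hi'
      exact absurd (hp _ hi) (by simp)
    -- The labels of the graph avoid `S`, so `F` may be replaced by `φ`, which then splits over the
    -- assignments `k`.
    rw [← L.eq_F_of_disjoint hφ hdisj, h2]
    · rw [← (Equiv.arrowCongr (Equiv.refl (Fin n)) ε).sum_comp]
      refine Finset.sum_congr rfl fun k _ => ?_
      simp only [Equiv.arrowCongr_apply, Function.comp_apply, Equiv.refl_symm, Equiv.refl_apply,
        Equiv.symm_apply_apply, Matrix.of_apply]
      congr 1
      have hΞ := L.mem_fib.1 (h1 k).1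
      rw [(L.isMulOver hΞ.1).map_multiset_prod]
      · refine congrArg Multiset.prod (Multiset.map_congr rfl fun z hz => ?_)
        have hne : (z.1 : ℕ) ≠ z.2 := fun hh => hE z hz (Fin.ext hh)
        -- This carries the reference edge to the edge at hand; the transpositions are disjoint
        -- because the edge is not a loop.
        let σ : Equiv.Perm ℕ := Equiv.swap u (u + 2 + z.1) * Equiv.swap (u + 1) (u + 2 + z.2)
        have hσu : σ u = u + 2 + z.1 := by
          rw [Equiv.Perm.mul_apply, Equiv.swap_apply_of_ne_of_ne (a := u + 1) (by omega) (by omega),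
            Equiv.swap_apply_left]
        have hσv : σ (u + 1) = u + 2 + z.2 := by
          rw [Equiv.Perm.mul_apply, Equiv.swap_apply_left,
            Equiv.swap_apply_of_ne_of_ne (by omega) (by omega)]
        have hσS : ∀ i ∈ S, σ i = i := by
          intro i hi
          have := hu i hi
          rw [Equiv.Perm.mul_apply, Equiv.swap_apply_of_ne_of_ne (a := u + 1) (by omega) (by omega),
            Equiv.swap_apply_of_ne_of_ne (by omega) (by omega)]
        have hpair := h.eq_pair huS hv (k z.1) (k z.2) hσS hΞ.1 ?_ ?_ ?_ hemem
        · rw [hact, hσu, hσv] at hpair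
          exact hpair
        · rw [Finset.image_insert, Finset.image_insert, hσu, hσv,
            (Finset.image_congr (g := id) fun i hi => hσS i hi).trans Finset.image_id]
          exact Finset.insert_subset (add_mem_extend S _ z.2.2) (Finset.insert_subset
            (add_mem_extend S _ z.1.2) (subset_extend S _ n))
        · rw [hσu]
          exact (h1 k).2 z.1
        · rw [hσv]
          exact (h1 k).2 z.2
      · intro z hz
        refine L.mono ?_ (he _ _)
        exact Finset.insert_subset (add_mem_extend S _ z.1.2) (Finset.singleton_subset_iff.2
            (add_mem_extend S _ z.2.2))
    · refine Submonoid.multiset_prod_mem _ _ fun y hy => ?_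
      obtain ⟨z, -, rfl⟩ := Multiset.mem_map.1 hy
      refine L.mono ?_ (he _ _)
      simp only [Finset.insert_subset_iff, Finset.singleton_subset_iff]
      exact ⟨Finset.mem_image_of_mem _ (Finset.mem_range.2 z.1.2),
        Finset.mem_image_of_mem _ (Finset.mem_range.2 z.2.2)⟩

end LabelSystem

/-! ### Graphs embedded in a common node set -/

namespace Multigraph

/-- `G` is embedded in `X` by `j`, with the edges `x`. -/
def Realizes {X : Type} (G : Multigraph) (j : G.V → X) (x : Multiset (Sym2 X)) : Prop :=
  Function.Injective j ∧ G.E.map (Sym2.map j) = x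

theorem Realizes.map {X Y : Type} {G : Multigraph} {j : G.V → X} {x : Multiset (Sym2 X)}
    (h : G.Realizes j x) {u : X → Y} (hu : Function.Injective u) :
    G.Realizes (u ∘ j) (x.map (Sym2.map u)) := by
  refine ⟨hu.comp h.1, ?_⟩
  rw [← h.2, Multiset.map_map]
  simp [Sym2.map_map]

/-- Follow one embedding by the inverse of the other. Embedding graphs in a common set thus replaces
explicit isomorphisms between products. -/
theorem Realizes.nonempty_iso {X : Type} {G G' : Multigraph} {j : G.V → X} {j' : G'.V → X}
    {x : Multiset (Sym2 X)} (h : G.Realizes j x) (h' : G'.Realizes j' x)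
    (hr : Set.range j = Set.range j') : Nonempty (G.Iso G') := by
  let e : G.V ≃ G'.V := (Equiv.ofInjective j h.1).trans
    ((Equiv.setCongr hr).trans (Equiv.ofInjective j' h'.1).symm)
  have he : ∀ v, j' (e v) = j v := by
    intro v
    have := Equiv.apply_ofInjective_symm h'.1 ((Equiv.setCongr hr) (Equiv.ofInjective j h.1 v))
    exact this
  refine ⟨⟨e, Multiset.map_injective (Sym2.map.injective h'.1) ?_⟩⟩
  rw [Multiset.map_map, h'.2, ← h.2]
  simp [Sym2.map_map, he]

theorem exists_realizes {X : Type} (A : Finset X) (x : Multiset (Sym2 X))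
    (hx : ∀ e ∈ x, ¬ e.IsDiag) (hA : ∀ e ∈ x, ∀ v ∈ e, v ∈ A) :
    ∃ E : Multiset (Sym2 A), ∃ hE : ∀ e ∈ E, ¬ e.IsDiag,
      (⟨A, E, hE⟩ : Multigraph).Realizes Subtype.val x := by
  have h : (x.attach.map fun e => e.1.attachWith (hA e.1 e.2)).map (Sym2.map Subtype.val) = x := by
    rw [Multiset.map_map]
    conv_rhs => rw [← Multiset.attach_map_val x]
    refine Multiset.map_congr rfl fun e _ => ?_
    exact Sym2.attachWith_map_subtypeVal _
  refine ⟨x.attach.map fun e => e.1.attachWith (hA e.1 e.2), fun e he hd => ?_,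
    Subtype.val_injective, h⟩
  refine hx (e.map Subtype.val) (h ▸ Multiset.mem_map_of_mem _ he) ?_
  induction e with
  | h a b => simpa using hd

instance : IsEmpty K₀.V := inferInstanceAs (IsEmpty (Fin 0))

theorem K₀_realizes {X : Type} (j : K₀.V → X) : K₀.Realizes j 0 :=
  ⟨Function.injective_of_subsingleton j, rfl⟩

/-- The graph on `V` without edges. -/
abbrev edgeless (V : Type) [Fintype V] : Multigraph where
  V := V
  E := 0
  loopless := by simp

theorem edgeless_realizes {X V : Type} [Fintype V] {j : V → X} (hj : Function.Injective j) :
    (edgeless V).Realizes j 0 :=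
  ⟨hj, rfl⟩

/-- A graph without labels as a `0`-labeled graph. -/
def unlabeled (G : Multigraph) : LabeledMultigraph 0 :=
  { G with label := ⟨Fin.elim0, fun i => i.elim0⟩ }

end Multigraph

namespace LabeledMultigraph

open Multigraph

variable {k : ℕ} {X : Type}

/-- The product of two labeled graphs embedded in a common set is embedded in that set. -/
theorem exists_glue_realizes (G₁ G₂ : LabeledMultigraph k) {j₁ : G₁.V → X} {j₂ : G₂.V → X}
    {x₁ x₂ : Multiset (Sym2 X)} (h₁ : G₁.Realizes j₁ x₁) (h₂ : G₂.Realizes j₂ x₂)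
    (hlabel : ∀ i, j₁ (G₁.label i) = j₂ (G₂.label i))
    (hinter : ∀ v w, j₁ v = j₂ w → ∃ i, v = G₁.label i ∧ w = G₂.label i) :
    ∃ j : (glue G₁ G₂).V → X, (glue G₁ G₂).Realizes j (x₁ + x₂) ∧
      Set.range j = Set.range j₁ ∪ Set.range j₂ := by
  let j : GlueV G₁ G₂ → X := Quot.lift (Sum.elim j₁ j₂) (by
    rintro _ _ ⟨i, rfl, rfl⟩
    exact hlabel i)
  have hl : ∀ v, j (glueInl G₁ G₂ v) = j₁ v := fun _ => rfl
  have hr : ∀ v, j (glueInr G₁ G₂ v) = j₂ v := fun _ => rfl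
  refine ⟨j, ⟨?_, ?_⟩, ?_⟩
  · rintro ⟨v | v⟩ ⟨w | w⟩ h
    · exact congrArg (glueInl G₁ G₂) (h₁.1 h)
    · obtain ⟨i, rfl, rfl⟩ := hinter v w h
      exact Quot.sound ⟨i, rfl, rfl⟩
    · obtain ⟨i, rfl, rfl⟩ := hinter w v h.symm
      exact (Quot.sound ⟨i, rfl, rfl⟩ : glueInl G₁ G₂ _ = glueInr G₁ G₂ _).symm
    · exact congrArg (glueInr G₁ G₂) (h₂.1 h)
  · change (G₁.E.map (Sym2.map (glueInl G₁ G₂)) + G₂.E.map (Sym2.map (glueInr G₁ G₂))).map _ = _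
    refine (Multiset.map_add _ _ _).trans (congrArg₂ (· + ·) ?_ ?_)
    · refine (Multiset.map_map _ _ _).trans ?_
      rw [← h₁.2]
      exact Multiset.map_congr rfl fun e _ => Sym2.map_map e
    · refine (Multiset.map_map _ _ _).trans ?_
      rw [← h₂.2]
      exact Multiset.map_congr rfl fun e _ => Sym2.map_map e
  · ext a
    constructor
    · rintro ⟨⟨v | v⟩, rfl⟩
      · exact Or.inl ⟨v, rfl⟩
      · exact Or.inr ⟨v, rfl⟩
    · rintro (⟨v, rfl⟩ | ⟨v, rfl⟩)
      · exact ⟨glueInl G₁ G₂ v, rfl⟩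
      · exact ⟨glueInr G₁ G₂ v, rfl⟩

/-- Inclusion–exclusion: the images of the factors cover the product and meet in the `k` labeled
nodes. -/
theorem card_glue (G₁ G₂ : LabeledMultigraph k) :
    Fintype.card (glue G₁ G₂).V + k = Fintype.card G₁.V + Fintype.card G₂.V := by
  classical
  have h1 : Set.range (glueInl G₁ G₂) ∪ Set.range (glueInr G₁ G₂) = Set.univ := by
    ext a
    obtain ⟨v | v⟩ := a
    · exact ⟨fun _ => trivial, fun _ => Or.inl ⟨v, rfl⟩⟩
    · exact ⟨fun _ => trivial, fun _ => Or.inr ⟨v, rfl⟩⟩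
  have h2 : Set.range (glueInl G₁ G₂) ∩ Set.range (glueInr G₁ G₂) =
      Set.range fun i => glueInl G₁ G₂ (G₁.label i) := by
    ext a
    constructor
    · rintro ⟨⟨v, rfl⟩, w, hw⟩
      by_contra hcon
      let F : GlueV G₁ G₂ → Prop := Quot.lift
        (Sum.elim (fun v => ∃ i, G₁.label i = v) fun _ => True) (by
          rintro _ _ ⟨i, rfl, rfl⟩
          simp)
      have h : F (glueInl G₁ G₂ v) := by
        rw [← hw]
        trivial
      obtain ⟨i, rfl⟩ := h
      exact hcon ⟨i, rfl⟩
    · rintro ⟨i, rfl⟩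
      exact ⟨⟨_, rfl⟩, G₂.label i, (Quot.sound ⟨i, rfl, rfl⟩ :
        glueInl G₁ G₂ (G₁.label i) = glueInr G₁ G₂ (G₂.label i)).symm⟩
  have : Finite (GlueV G₁ G₂) := inferInstanceAs (Finite (Quot _))
  have h3 := Set.ncard_union_add_ncard_inter (Set.range (glueInl G₁ G₂)) (Set.range (glueInr G₁ G₂))
  rw [h1, h2, Set.ncard_univ] at h3
  have h4 : (Set.range fun i => glueInl G₁ G₂ (G₁.label i)).ncard = k := by
    have hinj : Function.Injective fun i => glueInl G₁ G₂ (G₁.label i) :=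
      (glueInl_injective G₁ G₂).comp G₁.label.injective
    rw [← Set.image_univ, Set.ncard_image_of_injective _ hinj]
    simp
  rw [h4, ← Set.image_univ, Set.ncard_image_of_injective _ (glueInl_injective G₁ G₂),
    ← Set.image_univ, Set.ncard_image_of_injective _ (glueInr_injective G₁ G₂),
    Set.ncard_univ, Set.ncard_univ] at h3
  simp only [← Nat.card_eq_fintype_card]
  exact h3

end LabeledMultigraph

/-! ### Multiplicativity and normalization -/

namespace GraphParameter

open Multigraph LabeledMultigraph

variable (f : GraphParameter)

theorem eq_of_realizes {X : Type} {G G' : Multigraph} {j : G.V → X} {j' : G'.V → X}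
    {x : Multiset (Sym2 X)} (h : G.Realizes j x) (h' : G'.Realizes j' x)
    (hr : Set.range j = Set.range j') : f G = f G' :=
  f.iso_inv _ _ (h.nonempty_iso h' hr)

theorem connectionMatrix_apply {k : ℕ} (G₁ G₂ : LabeledMultigraph k) :
    f.connectionMatrix k ⟦G₁⟧ ⟦G₂⟧ = f (glue G₁ G₂).toMultigraph :=
  rfl

/-- The columns of a connection matrix of finite rank span a finite-dimensional space. -/
theorem finiteDimensional_col {k r : ℕ} (h : f.rankConn k ≤ r) :
    FiniteDimensional ℝ (Submodule.span ℝ (Set.range (f.connectionMatrix k).col)) ∧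
      Module.finrank ℝ (Submodule.span ℝ (Set.range (f.connectionMatrix k).col)) ≤ r := by
  have h1 : Module.rank ℝ (Submodule.span ℝ (Set.range (f.connectionMatrix k).col)) ≤ r := by
    rw [rankConn, Matrix.eRank] at h
    exact Cardinal.toENat_le_natCast.1 h
  exact ⟨Module.rank_lt_aleph0_iff.1 (h1.trans_lt Cardinal.natCast_lt_aleph0),
    Module.finrank_le_of_rank_le h1⟩

theorem eq_glue_of_disjoint {X : Type} {G G₁ G₂ : Multigraph} {j : G.V → X} {j₁ : G₁.V → X}
    {j₂ : G₂.V → X} {x₁ x₂ : Multiset (Sym2 X)} (h : G.Realizes j (x₁ + x₂))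
    (h₁ : G₁.Realizes j₁ x₁) (h₂ : G₂.Realizes j₂ x₂) (hdisj : ∀ v w, j₁ v ≠ j₂ w)
    (hr : Set.range j = Set.range j₁ ∪ Set.range j₂) :
    f G = f (glue G₁.unlabeled G₂.unlabeled).toMultigraph := by
  obtain ⟨j', h', hr'⟩ := exists_glue_realizes G₁.unlabeled G₂.unlabeled h₁ h₂
    (fun i => i.elim0) (fun v w hvw => absurd hvw (hdisj v w))
  exact f.eq_of_realizes h h' (hr.trans hr'.symm)

variable {f}

/-- If the connection matrix for `k = 0` has rank one, then `f` is multiplicative. -/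
theorem map_glue_unlabeled (hf₀ : f K₀ = 1) (h : f.rankConn 0 ≤ (1 : ℕ)) (G₁ G₂ : Multigraph) :
    f (glue G₁.unlabeled G₂.unlabeled).toMultigraph = f G₁ * f G₂ := by
  obtain ⟨h1, h2⟩ := f.finiteDimensional_col h
  obtain ⟨v, hv⟩ := finrank_le_one_iff.1 h2
  have hr : ∀ G : Multigraph, f (glue G.unlabeled K₀.unlabeled).toMultigraph = f G := by
    intro G
    refine (f.eq_glue_of_disjoint (X := G.V) (j := id) (j₁ := id) (j₂ := isEmptyElim)
      (x₁ := G.E) (x₂ := 0) ⟨Function.injective_id, ?_⟩ ⟨Function.injective_id, ?_⟩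
      (K₀_realizes _) (fun _ w => isEmptyElim w) ?_).symm
    · simp
    · simp
    · rw [Set.range_eq_empty (isEmptyElim : K₀.V → G.V), Set.union_empty]
  have hl : ∀ G : Multigraph, f (glue K₀.unlabeled G.unlabeled).toMultigraph = f G := by
    intro G
    refine (f.eq_glue_of_disjoint (X := G.V) (j := id) (j₂ := id) (j₁ := isEmptyElim)
      (x₂ := G.E) (x₁ := 0) ⟨Function.injective_id, ?_⟩ (K₀_realizes _)
      ⟨Function.injective_id, ?_⟩ (fun w _ => isEmptyElim w) ?_).symm
    · simp
    · simp
    · rw [Set.range_eq_empty (isEmptyElim : K₀.V → G.V), Set.empty_union]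
  have hcol : ∀ G : Multigraph, ∃ c : ℝ, ∀ H : Multigraph,
      c * v.1 ⟦H.unlabeled⟧ = f (glue H.unlabeled G.unlabeled).toMultigraph := by
    intro G
    obtain ⟨c, hc⟩ := hv ⟨(f.connectionMatrix 0).col ⟦G.unlabeled⟧, Submodule.subset_span ⟨_, rfl⟩⟩
    exact ⟨c, fun H => congrFun (congrArg Subtype.val hc) ⟦H.unlabeled⟧⟩
  obtain ⟨c₀, h₀⟩ := hcol K₀
  obtain ⟨c₂, h₂⟩ := hcol G₂
  have e1 := h₀ K₀
  have e2 := h₀ G₁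
  have e3 := h₂ K₀
  have e4 := h₂ G₁
  rw [hr] at e1 e2
  rw [hl] at e3
  rw [hf₀] at e1
  rw [← e4, ← e2, ← e3]
  -- The vanishing of the minor with rows `G₁`, `K₀` and columns `G₂`, `K₀`, whose corner entry is
  -- `f K₀ = 1`.
  linear_combination (- c₂ * v.1 ⟦G₁.unlabeled⟧) * e1

theorem map_edgeless (hf₀ : f K₀ = 1)
    (hmul : ∀ G₁ G₂ : Multigraph, f (glue G₁.unlabeled G₂.unlabeled).toMultigraph = f G₁ * f G₂)
    (V : Type) [Fintype V] : f (edgeless V) = f (edgeless (Fin 1)) ^ Fintype.card V := by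
  refine Fintype.induction_empty_option
    (P := fun V _ => f (edgeless V) = f (edgeless (Fin 1)) ^ Fintype.card V) ?_ ?_ ?_ V
  · intro V W _ e h
    let _ := Fintype.ofEquiv W e.symm
    rw [← Fintype.card_congr e, ← f.eq_of_realizes (edgeless_realizes e.injective)
      (edgeless_realizes Function.injective_id) (e.surjective.range_eq.trans Set.range_id.symm)]
    convert h
  · rw [Fintype.card_pempty, pow_zero, ← hf₀]
    exact f.eq_of_realizes (X := PEmpty) (edgeless_realizes (j := id) Function.injective_id)
      (x := 0) (j' := isEmptyElim) (K₀_realizes _) (Set.eq_empty_of_isEmpty _ |>.trans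
        (Set.eq_empty_of_isEmpty _).symm)
  · intro V _ h
    rw [Fintype.card_option, pow_succ, ← h, ← hmul]
    refine f.eq_glue_of_disjoint (X := Option V) (j := id) (j₁ := some) (j₂ := fun _ => none)
      (x₁ := 0) (x₂ := 0) (edgeless_realizes Function.injective_id)
      (edgeless_realizes (Option.some_injective V))
      (edgeless_realizes (Function.injective_of_subsingleton _)) (fun v _ => Option.some_ne_none v)
      ?_
    ext v
    cases v
    · exact ⟨fun _ => Or.inr ⟨0, rfl⟩, fun _ => ⟨none, rfl⟩⟩
    · exact ⟨fun _ => Or.inl ⟨_, rfl⟩, fun _ => ⟨some _, rfl⟩⟩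

/-- The normalization of `f` that takes the value `1` on the graph with one node. -/
noncomputable def normalize (f : GraphParameter) (G : Multigraph) : ℝ :=
  f G / f (edgeless (Fin 1)) ^ Fintype.card G.V

/-- `f` is multiplicative over disjoint unions and does not vanish on the graph with one node. -/
structure IsMultiplicative (f : GraphParameter) : Prop where
  null : f K₀ = 1
  mul : ∀ G₁ G₂ : Multigraph, f (glue G₁.unlabeled G₂.unlabeled).toMultigraph = f G₁ * f G₂
  pos : 0 < f (edgeless (Fin 1))

/-- The additional nodes of `G'` are isolated, so they contribute a power of the one-node value,
which the normalization cancels. -/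
theorem IsMultiplicative.normalize_eq_of_subset (hf : f.IsMultiplicative) {X : Type}
    {G G' : Multigraph} {j : G.V → X} {j' : G'.V → X} {x : Multiset (Sym2 X)}
    (h : G.Realizes j x) (h' : G'.Realizes j' x) (hr : Set.range j ⊆ Set.range j') :
    f.normalize G = f.normalize G' := by
  classical
  let C : Set G'.V := {v | j' v ∉ Set.range j}
  have hunion : Set.range j' = Set.range j ∪ Set.range fun v : C => j' v := by
    ext a
    constructor
    · rintro ⟨v, rfl⟩
      by_cases hv : j' v ∈ Set.range j
      · exact Or.inl hv
      · exact Or.inr ⟨⟨v, hv⟩, rfl⟩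
    · rintro (ha | ⟨v, rfl⟩)
      · exact hr ha
      · exact ⟨v, rfl⟩
  have hinj : Function.Injective fun v : C => j' v := h'.1.comp Subtype.val_injective
  have h1 : f G' = f G * f (edgeless C) := by
    rw [← hf.mul]
    refine f.eq_glue_of_disjoint (x₁ := x) (x₂ := 0) (by rwa [add_zero]) h (edgeless_realizes hinj)
      (fun v w hvw => w.2 ⟨v, hvw⟩) hunion
  have h2 : Fintype.card G'.V = Fintype.card G.V + Fintype.card C := by
    have hd : Disjoint (Set.range j) (Set.range fun v : C => j' v) := by
      refine Set.disjoint_left.2 ?_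
      rintro a ha ⟨v, rfl⟩
      exact v.2 ha
    have := Set.ncard_union_eq hd (Set.finite_range _) (Set.finite_range _)
    rw [← hunion, ← Set.image_univ, Set.ncard_image_of_injective _ h'.1, ← Set.image_univ,
      Set.ncard_image_of_injective _ h.1, ← Set.image_univ, Set.ncard_image_of_injective _ hinj]
      at this
    simpa [Set.ncard_univ, Nat.card_eq_fintype_card] using this
  rw [normalize, normalize, h1, h2, map_edgeless hf.null hf.mul C, pow_add]
  have := hf.pos
  field_simp

theorem IsMultiplicative.normalize_eq (hf : f.IsMultiplicative) {X : Type} {G G' : Multigraph}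
    {j : G.V → X} {j' : G'.V → X} {x : Multiset (Sym2 X)} (h : G.Realizes j x)
    (h' : G'.Realizes j' x) : f.normalize G = f.normalize G' := by
  classical
  -- Compare both graphs with the one on the union of their node sets.
  obtain ⟨E, hE, hU⟩ := exists_realizes (Finset.univ.image j ∪ Finset.univ.image j') x (by
      intro e he
      rw [← h.2] at he
      obtain ⟨e, h1, rfl⟩ := Multiset.mem_map.1 he
      exact not_isDiag_map h.1 e (G.loopless e h1)) (by
      intro e he v hv
      rw [← h.2] at he
      obtain ⟨e, he, rfl⟩ := Multiset.mem_map.1 he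
      obtain ⟨w, -, rfl⟩ := Sym2.mem_map.1 hv
      exact Finset.mem_union_left _ (Finset.mem_image_of_mem _ (Finset.mem_univ _)))
  rw [hf.normalize_eq_of_subset h hU, hf.normalize_eq_of_subset h' hU]
  · rintro _ ⟨v, rfl⟩
    exact ⟨⟨j' v, Finset.mem_union_right _ (Finset.mem_image_of_mem _ (Finset.mem_univ _))⟩, rfl⟩
  · rintro _ ⟨v, rfl⟩
    exact ⟨⟨j v, Finset.mem_union_left _ (Finset.mem_image_of_mem _ (Finset.mem_univ _))⟩, rfl⟩

open Classical in
/-- The edges that are not loops. -/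
noncomputable def noLoops {X : Type} (x : Multiset (Sym2 X)) : Multiset (Sym2 X) :=
  x.filter fun e => ¬ e.IsDiag

theorem noLoops_map {X Y : Type} {u : X → Y} (hu : Function.Injective u) (x : Multiset (Sym2 X)) :
    noLoops (x.map (Sym2.map u)) = (noLoops x).map (Sym2.map u) := by
  classical
  rw [noLoops, noLoops, Multiset.filter_map]
  congr 1
  refine Multiset.filter_congr fun e _ => ?_
  induction e with
  | h a b => simp [hu.eq_iff]

theorem noLoops_add {X : Type} (x y : Multiset (Sym2 X)) :
    noLoops (x + y) = noLoops x + noLoops y := by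
  classical
  simp [noLoops]

theorem noLoops_eq_self {X : Type} {x : Multiset (Sym2 X)} (h : ∀ e ∈ x, ¬ e.IsDiag) :
    noLoops x = x := by
  classical
  exact Multiset.filter_eq_self.2 h

theorem exists_realizes_noLoops {X : Type} (B : Finset X) (x : Multiset (Sym2 X)) :
    ∃ A : Finset X, B ⊆ A ∧ (∀ v ∈ A, v ∈ B ∨ ∃ e ∈ x, v ∈ e) ∧ ∃ E : Multiset (Sym2 A),
      ∃ hE : ∀ e ∈ E, ¬ e.IsDiag,
        (⟨A, E, hE⟩ : Multigraph).Realizes Subtype.val (noLoops x) := by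
  classical
  refine ⟨B ∪ x.toFinset.biUnion Sym2.toFinset, Finset.subset_union_left, fun v hv => ?_,
    exists_realizes _ _ (fun e he => (Multiset.mem_filter.1 he).2) fun e he v hv => ?_⟩
  · simpa using hv
  · simp only [Finset.mem_union, Finset.mem_biUnion, Multiset.mem_toFinset, Sym2.mem_toFinset]
    exact Or.inr ⟨e, (Multiset.mem_filter.1 he).1, hv⟩

open Classical in
/-- The normalized value of `f` on the graph with the given edges and any number of isolated nodes;
loops are disregarded. -/
noncomputable def edgeValue (f : GraphParameter) {X : Type} (x : Multiset (Sym2 X)) : ℝ :=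
  f.normalize ⟨_, _, (exists_realizes_noLoops ∅ x).choose_spec.2.2.choose_spec.choose⟩

theorem IsMultiplicative.edgeValue_eq (hf : f.IsMultiplicative) {X : Type} {x : Multiset (Sym2 X)}
    {G : Multigraph} {j : G.V → X} (h : G.Realizes j (noLoops x)) :
    f.edgeValue x = f.normalize G :=
  hf.normalize_eq (exists_realizes_noLoops ∅ x).choose_spec.2.2.choose_spec.choose_spec h

theorem IsMultiplicative.edgeValue_map (hf : f.IsMultiplicative) {X Y : Type} {u : X → Y}
    (hu : Function.Injective u) (x : Multiset (Sym2 X)) :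
    f.edgeValue (x.map (Sym2.map u)) = f.edgeValue x := by
  obtain ⟨A, -, -, E, hE, h⟩ := exists_realizes_noLoops ∅ x
  have h' := h.map hu
  rw [← noLoops_map hu] at h'
  rw [hf.edgeValue_eq h, hf.edgeValue_eq h']

theorem IsMultiplicative.edgeValue_zero (hf : f.IsMultiplicative) {X : Type} :
    f.edgeValue (0 : Multiset (Sym2 X)) = 1 := by
  rw [hf.edgeValue_eq (G := K₀) (j := isEmptyElim) (K₀_realizes _), normalize, hf.null]
  simp

end GraphParameter

/-! ### The commutative monoid of partially labeled edge patterns -/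

section Patterns

/-- Edges between nodes that are either labeled (`Sum.inl`) or unlabeled (`Sum.inr`). -/
abbrev Pattern := Multiset (Sym2 (ℕ ⊕ ℕ))

namespace Pattern

/-- Renaming of the nodes. -/
def rename (u : ℕ ⊕ ℕ → ℕ ⊕ ℕ) (x : Pattern) : Pattern := x.map (Sym2.map u)

theorem rename_rename (u v : ℕ ⊕ ℕ → ℕ ⊕ ℕ) (x : Pattern) :
    rename v (rename u x) = rename (v ∘ u) x := by
  simp [rename, Sym2.map_map]

theorem rename_add (u : ℕ ⊕ ℕ → ℕ ⊕ ℕ) (x y : Pattern) :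
    rename u (x + y) = rename u x + rename u y :=
  Multiset.map_add _ _ _

theorem rename_congr {u v : ℕ ⊕ ℕ → ℕ ⊕ ℕ} {x : Pattern} (h : ∀ e ∈ x, ∀ a ∈ e, u a = v a) :
    rename u x = rename v x :=
  Multiset.map_congr rfl fun e he => Sym2.map_congr (h e he)

theorem rename_id (x : Pattern) : rename id x = x := by
  simp [rename]

/-- The nodes of the first factor in a product. -/
def left : ℕ ⊕ ℕ → ℕ ⊕ ℕ := Sum.map id (2 * ·)

/-- The nodes of the second factor in a product. -/
def right : ℕ ⊕ ℕ → ℕ ⊕ ℕ := Sum.map id (2 * · + 1)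

theorem left_injective : Function.Injective left :=
  Function.injective_id.sumMap fun a b h => by simpa using h

theorem right_injective : Function.Injective right :=
  Function.injective_id.sumMap fun a b h => by simpa using h

/-- The product of two patterns: the unlabeled nodes are made disjoint. -/
def prod (x y : Pattern) : Pattern := rename left x + rename right y

/-- All labels are in `S`. -/
def LabelsIn (S : Finset ℕ) (x : Pattern) : Prop := ∀ e ∈ x, ∀ i, Sum.inl i ∈ e → i ∈ S

theorem LabelsIn.rename {S T : Finset ℕ} {u : ℕ ⊕ ℕ → ℕ ⊕ ℕ} {x : Pattern} (hx : LabelsIn S x)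
    (hl : ∀ i ∈ S, ∀ j, u (Sum.inl i) = Sum.inl j → j ∈ T)
    (hr : ∀ n j, u (Sum.inr n) = Sum.inl j → j ∈ T) : LabelsIn T (rename u x) := by
  intro e he j hj
  obtain ⟨e, he', rfl⟩ := Multiset.mem_map.1 he
  obtain ⟨a | n, ha, haj⟩ := Sym2.mem_map.1 hj
  · exact hl a (hx e he' a ha) j haj
  · exact hr n j haj

theorem LabelsIn.prod {S : Finset ℕ} {x y : Pattern} (hx : LabelsIn S x) (hy : LabelsIn S y) :
    LabelsIn S (prod x y) := by
  intro e he
  rcases Multiset.mem_add.1 he with he | he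
  · exact hx.rename (fun i hi j h => by
        simp only [left, Sum.map_inl, id, Sum.inl.injEq] at h
        exact h ▸ hi)
      (fun n j h => by simp [left] at h) e he
  · exact hy.rename (fun i hi j h => by
        simp only [right, Sum.map_inl, id, Sum.inl.injEq] at h
        exact h ▸ hi)
      (fun n j h => by simp [right] at h) e he

theorem exists_labelsIn (x : Pattern) : ∃ S, LabelsIn S x := by
  classical
  refine ⟨x.toFinset.biUnion fun e =>
    e.toFinset.preimage Sum.inl Sum.inl_injective.injOn, fun e he i hi => ?_⟩
  simp only [Finset.mem_biUnion, Multiset.mem_toFinset, Finset.mem_preimage, Sym2.mem_toFinset]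
  exact ⟨e, he, hi⟩

end Pattern

/-- A function of patterns that does not depend on the names of the nodes. -/
structure PatternFunction where
  toFun : Pattern → ℝ
  map_rename : ∀ {u}, Function.Injective u → ∀ x, toFun (Pattern.rename u x) = toFun x
  zero : toFun 0 = 1

namespace PatternFunction

open Pattern

variable (F : PatternFunction)

/-- Two patterns are equivalent if their products with all patterns have the same value. -/
def setoid : Setoid Pattern where
  r x y := ∀ z, F.toFun (prod x z) = F.toFun (prod y z)
  iseqv := ⟨fun _ _ => rfl, fun h z => (h z).symm, fun h h' z => (h z).trans (h' z)⟩

/-- The monoid of patterns up to equivalence. -/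
def Classes : Type := Quotient F.setoid

variable {F}

/-- The class of a pattern. -/
def cls (x : Pattern) : F.Classes := Quotient.mk F.setoid x

theorem cls_eq {x y : Pattern} : (cls x : F.Classes) = cls y ↔
    ∀ z, F.toFun (prod x z) = F.toFun (prod y z) :=
  Quotient.eq (r := F.setoid)

theorem cls_surjective (a : F.Classes) : ∃ x, cls x = a := Quotient.exists_rep a

/-- Doubling of an injection of the unlabeled nodes on the left factor. -/
def onLeft (τ : ℕ → ℕ) (n : ℕ) : ℕ := if n % 2 = 0 then 2 * τ (n / 2) else n

theorem onLeft_injective {τ : ℕ → ℕ} (hτ : Function.Injective τ) :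
    Function.Injective (onLeft τ) := by
  intro a b h
  unfold onLeft at h
  split_ifs at h
  · have := @hτ (a / 2) (b / 2) (by omega)
    omega
  · omega
  · omega
  · omega

theorem cls_rename {τ : ℕ → ℕ} (hτ : Function.Injective τ) (x : Pattern) :
    (cls (Pattern.rename (Sum.map id τ) x) : F.Classes) = cls x := by
  refine cls_eq.2 fun z => ?_
  rw [← F.map_rename (u := Sum.map id (onLeft τ))
    (Function.injective_id.sumMap (onLeft_injective hτ)) (prod x z)]
  congr 1
  simp only [prod, rename_add, rename_rename]
  congr 2
  · ext (a | a) <;> simp [left, onLeft]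
  · ext (a | a)
    · simp [right]
    · simp [right, onLeft, Nat.add_mod]

theorem prod_comm_eq (x y : Pattern) : (cls (prod x y) : F.Classes) = cls (prod y x) := by
  -- Exchange the even codes of the first factor with the odd codes of the second.
  rw [← cls_rename (τ := fun n => if n % 2 = 0 then n + 1 else n - 1) (by
    intro a b h
    simp only at h
    split_ifs at h <;> omega)]
  congr 1
  rw [prod, rename_add, rename_rename, rename_rename, add_comm, prod]
  congr 2
  · ext (a | a)
    · simp [left, right]
    · simp [left, right, Nat.add_mod]
  · ext (a | a) <;> simp [left, right]

/-- The renaming of unlabeled nodes that exhibits the associativity of the product. -/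
def assocMap (n : ℕ) : ℕ :=
  -- Node `n` of the three factors has code `4n`, `4n + 2`, `2n + 1` when bracketed to the left, and
  -- `2n`, `4n + 1`, `4n + 3` when bracketed to the right.
  if n % 4 = 0 then n / 2 else if n % 4 = 2 then n - 1 else 2 * n + 1

theorem assocMap_injective : Function.Injective assocMap := by
  intro a b h
  unfold assocMap at h
  split_ifs at h <;> omega

theorem rename_assocMap (x y z : Pattern) :
    Pattern.rename (Sum.map id assocMap) (prod (prod x y) z) = prod x (prod y z) := by
  simp only [prod, rename_add, rename_rename, add_assoc]
  refine congrArg₂ (· + ·) (rename_congr ?_) (congrArg₂ (· + ·) (rename_congr ?_) (rename_congr ?_))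
  all_goals
    rintro e - (a | a) -
    · simp [left, right]
    · simp only [left, right, assocMap, Function.comp_apply, Sum.map_inr, Sum.inr.injEq]
      split_ifs <;> omega

theorem prod_assoc_eq (x y z : Pattern) :
    (cls (prod (prod x y) z) : F.Classes) = cls (prod x (prod y z)) := by
  rw [← rename_assocMap, cls_rename assocMap_injective]

theorem toFun_assoc (x y z : Pattern) :
    F.toFun (prod (prod x y) z) = F.toFun (prod x (prod y z)) := by
  rw [← rename_assocMap, F.map_rename (Function.injective_id.sumMap assocMap_injective)]

theorem rename_prod {u : ℕ ⊕ ℕ → ℕ ⊕ ℕ} {σ : ℕ → ℕ} (hu : u = Sum.map σ id) (x y : Pattern) :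
    Pattern.rename u (prod x y) = prod (Pattern.rename u x) (Pattern.rename u y) := by
  subst hu
  simp only [prod, rename_add, rename_rename]
  congr 2
  · ext (a | a) <;> simp [left]
  · ext (a | a) <;> simp [right]

theorem prod_zero_eq (x : Pattern) : (cls (prod x 0) : F.Classes) = cls x := by
  rw [← cls_rename (τ := (2 * ·)) (fun a b h => by simpa using h) x]
  simp [prod, Pattern.rename, left]

theorem prod_left_congr {x x' : Pattern} (h : (cls x : F.Classes) = cls x') (y : Pattern) :
    (cls (prod x y) : F.Classes) = cls (prod x' y) :=
  cls_eq.2 fun z => by rw [toFun_assoc, toFun_assoc, cls_eq.1 h]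

/-- The product of patterns is commutative and associative only up to renaming unlabeled nodes,
which does not change classes. -/
noncomputable instance : CommMonoid F.Classes where
  mul := Quotient.map₂ (sa := F.setoid) (sb := F.setoid) (sc := F.setoid) prod
      fun x x' hx y y' hy => by
    refine cls_eq.1 ((prod_left_congr (cls_eq.2 hx) y).trans ?_)
    rw [prod_comm_eq, prod_comm_eq x']
    exact prod_left_congr (cls_eq.2 hy) x'
  one := cls 0
  mul_assoc := by
    rintro ⟨x⟩ ⟨y⟩ ⟨z⟩
    exact prod_assoc_eq x y z
  mul_comm := by
    rintro ⟨x⟩ ⟨y⟩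
    exact prod_comm_eq x y
  one_mul := by
    rintro ⟨x⟩
    exact (prod_comm_eq 0 x).trans (prod_zero_eq x)
  mul_one := by
    rintro ⟨x⟩
    exact prod_zero_eq x

theorem cls_mul (x y : Pattern) : (cls x * cls y : F.Classes) = cls (prod x y) := rfl

theorem toFun_prod_zero (x : Pattern) : F.toFun (prod x 0) = F.toFun x := by
  rw [← F.map_rename left_injective x]
  simp [prod, Pattern.rename]

/-- The value of a class. -/
noncomputable def value : F.Classes → ℝ := Quotient.lift (s := F.setoid) F.toFun fun x y h => by
  rw [← toFun_prod_zero x, ← toFun_prod_zero y]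
  exact h 0

theorem value_mk (x : Pattern) : value (cls x : F.Classes) = F.toFun x := rfl

theorem cls_relabel_congr (σ : Equiv.Perm ℕ) {x y : Pattern} (h : (cls x : F.Classes) = cls y) :
    (cls (Pattern.rename (Sum.map σ id) x) : F.Classes) =
      cls (Pattern.rename (Sum.map σ id) y) := by
  refine cls_eq.2 fun z => ?_
  have hz : z = Pattern.rename (Sum.map σ id) (Pattern.rename (Sum.map σ.symm id) z) := by
    rw [rename_rename]
    conv_lhs => rw [← rename_id z]
    congr 1
    ext (a | a) <;> simp
  have hinj : Function.Injective (Sum.map σ (id : ℕ → ℕ)) :=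
    σ.injective.sumMap Function.injective_id
  rw [hz, ← rename_prod rfl, ← rename_prod rfl, F.map_rename hinj, F.map_rename hinj]
  exact cls_eq.1 h _

/-- Relabeling of classes. -/
noncomputable def relabel (σ : Equiv.Perm ℕ) : F.Classes →* F.Classes where
  toFun := Quotient.map (sa := F.setoid) (sb := F.setoid) (Pattern.rename (Sum.map σ id))
    fun _ _ h =>
    cls_eq.1 (cls_relabel_congr σ (cls_eq.2 h))
  map_one' := rfl
  map_mul' := by
    rintro ⟨x⟩ ⟨y⟩
    exact congrArg cls (rename_prod rfl x y)

/-- The classes of patterns with labels in `S`. -/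
def withLabels (S : Finset ℕ) : Submonoid F.Classes where
  carrier := {a | ∃ x, LabelsIn S x ∧ cls x = a}
  one_mem' := ⟨0, fun e he => absurd he (Multiset.notMem_zero e), rfl⟩
  mul_mem' := by
    rintro _ _ ⟨x, hx, rfl⟩ ⟨y, hy, rfl⟩
    exact ⟨prod x y, hx.prod hy, rfl⟩

theorem withLabels_mono {S T : Finset ℕ} (h : S ⊆ T) :
    (withLabels S : Submonoid F.Classes) ≤ withLabels T := by
  rintro _ ⟨x, hx, rfl⟩
  exact ⟨x, fun e he i hi => h (hx e he i hi), rfl⟩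

theorem exists_mem_withLabels (a : F.Classes) : ∃ S, a ∈ withLabels S := by
  obtain ⟨x, rfl⟩ := cls_surjective a
  obtain ⟨S, hS⟩ := Pattern.exists_labelsIn x
  exact ⟨S, x, hS, rfl⟩

/-- Turns the labels outside `U` into unlabeled nodes. -/
def forget (U : Finset ℕ) : ℕ ⊕ ℕ → ℕ ⊕ ℕ :=
  Sum.elim (fun i => if i ∈ U then Sum.inl i else Sum.inr (2 * i)) fun n => Sum.inr (2 * n + 1)

/-- An injective renaming under which the left factor of a product is mapped by `forget U`. -/
def forgetRight (U : Finset ℕ) : ℕ ⊕ ℕ → ℕ ⊕ ℕ :=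
  Sum.elim (fun i => if i ∈ U then Sum.inl i else Sum.inr (4 * i + 1)) fun n =>
    Sum.inr (if n % 2 = 0 then n else 2 * n + 1)

theorem forgetRight_injective (U : Finset ℕ) : Function.Injective (forgetRight U) := by
  rintro (a | a) (b | b) h
  · simp only [forgetRight, Sum.elim_inl] at h
    split_ifs at h
    · exact h
    · simp only [Sum.inr.injEq] at h
      congr 1
      omega
  · simp only [forgetRight, Sum.elim_inl, Sum.elim_inr] at h
    split_ifs at h <;> simp only [Sum.inr.injEq] at h <;> omega
  · simp only [forgetRight, Sum.elim_inl, Sum.elim_inr] at h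
    split_ifs at h <;> simp only [Sum.inr.injEq] at h <;> omega
  · simp only [forgetRight, Sum.elim_inr, Sum.inr.injEq] at h
    congr 1
    split_ifs at h <;> omega

/-- A label outside `U` meets no equal label in the other factor, so turning it into an unlabeled
node is an injective renaming of the product. -/
theorem exists_unlabel {T : Finset ℕ} {a : F.Classes} (U : Finset ℕ) (ha : a ∈ withLabels T) :
    ∃ a' ∈ withLabels (T ∩ U), ∀ b ∈ withLabels U, value (b * a) = value (b * a') := by
  obtain ⟨x, hx, rfl⟩ := ha
  refine ⟨cls (Pattern.rename (forget U) x), ⟨_, hx.rename (fun i hi j h => ?_)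
    (fun n j h => ?_), rfl⟩, ?_⟩
  · simp only [forget, Sum.elim_inl] at h
    split_ifs at h with hU
    · obtain rfl := Sum.inl.inj h
      exact Finset.mem_inter.2 ⟨hi, hU⟩
  · simp [forget] at h
  · rintro _ ⟨y, hy, rfl⟩
    rw [cls_mul, cls_mul, value_mk, value_mk, ← F.map_rename (forgetRight_injective U) (prod y x)]
    congr 1
    simp only [prod, rename_add, rename_rename]
    refine congrArg₂ (· + ·) (rename_congr ?_) (rename_congr ?_)
    · rintro e he (a | a) ha
      · simp [left, forgetRight, hy e he a ha]
      · simp [left, forgetRight]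
    · rintro e he (a | a) ha
      · simp only [right, forgetRight, forget, Function.comp_apply, Sum.map_inl, Sum.elim_inl, id]
        split_ifs
        · rfl
        · simp only [Sum.map_inr, Sum.inr.injEq]
          omega
      · simp only [right, forgetRight, forget, Function.comp_apply, Sum.map_inr, Sum.elim_inr,
          Sum.inr.injEq]
        split_ifs <;> omega

end PatternFunction

end Patterns

/-! ### The label system of a graph parameter -/

namespace GraphParameter

open Multigraph LabeledMultigraph PatternFunction

variable {f : GraphParameter}

/-- The normalization of `f` as a function of patterns. -/
noncomputable def IsMultiplicative.patternFunction (hf : f.IsMultiplicative) : PatternFunction where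
  toFun := f.edgeValue
  map_rename hu x := hf.edgeValue_map hu x
  zero := hf.edgeValue_zero

/-- The labeled graph `G` belongs to the class `a`, with the labels renamed by `s`. -/
def Represents {F : PatternFunction} {k : ℕ} {S : Finset ℕ} (s : Fin k ≃ S)
    (G : LabeledMultigraph k) (a : F.Classes) : Prop :=
  ∃ (j : G.V → ℕ ⊕ ℕ) (x : Pattern), cls x = a ∧ G.Realizes j (noLoops x) ∧
    (∀ i, j (G.label i) = Sum.inl (s i : ℕ)) ∧ ∀ v i, j v = Sum.inl i → i ∈ S

theorem exists_represents {F : PatternFunction} {k : ℕ} {S : Finset ℕ} (s : Fin k ≃ S)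
    {a : F.Classes} (ha : a ∈ withLabels S) : ∃ G : LabeledMultigraph k, Represents s G a := by
  classical
  obtain ⟨x, hx, rfl⟩ := ha
  -- Labels of `S` on no edge must still be nodes, so they are added as isolated ones.
  obtain ⟨A, hSA, hA, E, hE, h⟩ := exists_realizes_noLoops (S.image Sum.inl) x
  let lab : Fin k ↪ A := ⟨fun i => ⟨Sum.inl (s i : ℕ), hSA (Finset.mem_image_of_mem _ (s i).2)⟩,
    fun i i' hi => s.injective (Subtype.ext (Sum.inl_injective (congrArg Subtype.val hi)))⟩
  refine ⟨⟨⟨A, E, hE⟩, lab⟩, Subtype.val, x, rfl, h, fun _ => rfl, ?_⟩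
  rintro ⟨v, hv⟩ i rfl
  rcases hA _ hv with h1 | ⟨e, he, h1⟩
  · simpa using h1
  · exact hx e he i h1

/-- By `card_glue` the normalizing power splits over the factors. The kernel of the normalized
parameter is thus a positively rescaled connection matrix, with repeated or omitted rows and
columns, so positivity and rank bounds carry over. -/
theorem Represents.value_mul (hf : f.IsMultiplicative) {k : ℕ} {S : Finset ℕ} {s : Fin k ≃ S}
    {G₁ G₂ : LabeledMultigraph k} {a b : hf.patternFunction.Classes} (h₁ : Represents s G₁ a)
    (h₂ : Represents s G₂ b) :
    value (a * b) = f (edgeless (Fin 1)) ^ k * ((f (edgeless (Fin 1)) ^ Fintype.card G₁.V)⁻¹ *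
      f (glue G₁ G₂).toMultigraph * (f (edgeless (Fin 1)) ^ Fintype.card G₂.V)⁻¹) := by
  obtain ⟨j₁, x₁, rfl, hr₁, hl₁, hS₁⟩ := h₁
  obtain ⟨j₂, x₂, rfl, hr₂, hl₂, hS₂⟩ := h₂
  have hlab : ∀ {G : LabeledMultigraph k} {j : G.V → ℕ ⊕ ℕ} (_ : Function.Injective j)
      (_ : ∀ i, j (G.label i) = Sum.inl (s i : ℕ)) (_ : ∀ v i, j v = Sum.inl i → i ∈ S) {v : G.V}
      {i : ℕ} (h : j v = Sum.inl i), ∃ t, (s t : ℕ) = i ∧ v = G.label t := by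
    intro G j hj hl hS v i h
    refine ⟨s.symm ⟨i, hS v i h⟩, by simp, hj ?_⟩
    rw [h, hl]
    simp
  obtain ⟨j, hj, -⟩ := exists_glue_realizes G₁ G₂ (hr₁.map Pattern.left_injective)
    (hr₂.map Pattern.right_injective) (fun i => by
      simp [hl₁, hl₂, Pattern.left, Pattern.right]) (fun v w hvw => by
      simp only [Function.comp_apply, Pattern.left, Pattern.right] at hvw
      rcases hv : j₁ v with i | n <;> rcases hw : j₂ w with i' | n' <;> rw [hv, hw] at hvw
      · simp only [Sum.map_inl, id, Sum.inl.injEq] at hvw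
        obtain ⟨t, ht, rfl⟩ := hlab hr₁.1 hl₁ hS₁ hv
        obtain ⟨t', ht', rfl⟩ := hlab hr₂.1 hl₂ hS₂ hw
        have : t = t' := s.injective (Subtype.ext (by omega))
        exact ⟨t, rfl, by rw [this]⟩
      · simp at hvw
      · simp at hvw
      · simp only [Sum.map_inr, Sum.inr.injEq] at hvw
        omega)
  rw [← noLoops_map Pattern.left_injective, ← noLoops_map Pattern.right_injective,
    ← noLoops_add] at hj
  have h : value (cls x₁ * cls x₂ : hf.patternFunction.Classes) =
      f.normalize (glue G₁ G₂).toMultigraph := hf.edgeValue_eq hj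
  have hc := hf.pos
  have hcard := card_glue G₁ G₂
  rw [h, normalize, div_eq_iff (pow_ne_zero _ hc.ne')]
  set c := f (edgeless (Fin 1))
  set m := Fintype.card (glue G₁ G₂).V
  calc _ = (c ^ k * c ^ m) * ((c ^ Fintype.card G₁.V)⁻¹ * (c ^ Fintype.card G₂.V)⁻¹) *
        f (glue G₁ G₂).toMultigraph := by
          rw [← pow_add, add_comm k, hcard, pow_add]
          field_simp
    _ = _ := by ring

theorem posSemidefOn_withLabels (hf : f.IsMultiplicative) (hpos : f.ReflectionPositive)
    (S : Finset ℕ) : PosSemidefOn (withLabels S) (value (F := hf.patternFunction)) := by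
  intro c
  choose G hG using fun a : withLabels (F := hf.patternFunction) S =>
    exists_represents S.equivFin.symm a.2
  have hc := hf.pos
  set c₁ := f (edgeless (Fin 1)) with hc₁
  let D : withLabels (F := hf.patternFunction) S → ℝ := fun a => (c₁ ^ Fintype.card (G a).V)⁻¹
  have h := ((hpos S.card).submatrix fun a => ⟦G a⟧).2
    (Finsupp.onFinset c.support (fun a => c a * D a) fun a ha => by
      rw [Finsupp.mem_support_iff]
      exact left_ne_zero_of_mul ha)
  rw [Finsupp.onFinset_sum _ (by simp)] at h
  refine (mul_nonneg (pow_nonneg hc.le S.card) h).trans_eq ?_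
  rw [Finset.mul_sum, Finsupp.sum]
  refine Finset.sum_congr rfl fun a _ => ?_
  rw [Finsupp.onFinset_sum _ (by simp), Finset.mul_sum, Finsupp.sum]
  refine Finset.sum_congr rfl fun b _ => ?_
  rw [(hG a).value_mul hf (hG b), Matrix.submatrix_apply, connectionMatrix_apply, ← hc₁,
    star_trivial]
  simp only [D]
  ring

theorem finiteDimensional_translateSpan (hf : f.IsMultiplicative) {S : Finset ℕ} {r : ℕ}
    (h : f.rankConn S.card ≤ r) :
    FiniteDimensional ℝ (translateSpan (withLabels S) (value (F := hf.patternFunction))) ∧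
      Module.finrank ℝ (translateSpan (withLabels S) (value (F := hf.patternFunction))) ≤ r := by
  obtain ⟨h1, h2⟩ := f.finiteDimensional_col h
  choose G hG using fun a : withLabels (F := hf.patternFunction) S =>
    exists_represents S.equivFin.symm a.2
  -- Translates are functions of all classes, but unlabeling reduces each argument to one with
  -- labels in `S`, hence to a row of the connection matrix.
  have hex : ∀ x : hf.patternFunction.Classes, ∃ y : withLabels (F := hf.patternFunction) S,
      ∀ b ∈ withLabels S, value (b * x) = value (b * (y : hf.patternFunction.Classes)) := by
    intro x
    obtain ⟨T, hT⟩ := exists_mem_withLabels x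
    obtain ⟨y, hy, h⟩ := exists_unlabel S hT
    exact ⟨⟨y, withLabels_mono Finset.inter_subset_right hy⟩, h⟩
  choose g hg using hex
  set c₁ := f (edgeless (Fin 1)) with hc₁
  let D : withLabels (F := hf.patternFunction) S → ℝ := fun a => (c₁ ^ Fintype.card (G a).V)⁻¹
  let Θ : (LabeledType S.card → ℝ) →ₗ[ℝ] (hf.patternFunction.Classes → ℝ) :=
    { toFun := fun h x => c₁ ^ S.card * D (g x) * h ⟦G (g x)⟧
      map_add' := fun h h' => by
        ext x
        exact mul_add _ _ _
      map_smul' := fun t h => by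
        ext x
        exact mul_left_comm _ _ _ }
  have hle : translateSpan (withLabels S) (value (F := hf.patternFunction)) ≤
      (Submodule.span ℝ (Set.range (f.connectionMatrix S.card).col)).map Θ := by
    rw [translateSpan, Submodule.span_le]
    rintro _ ⟨a, rfl⟩
    refine ⟨D a • (f.connectionMatrix S.card).col ⟦G a⟧,
      Submodule.smul_mem _ _ (Submodule.subset_span ⟨_, rfl⟩), ?_⟩
    ext x
    change _ = value (a.1 * x)
    rw [hg x a a.2, mul_comm, (hG (g x)).value_mul hf (hG a), ← hc₁]
    change c₁ ^ S.card * D (g x) * (D a * f (glue (G (g x)) (G a)).toMultigraph) = _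
    simp only [D]
    ring
  exact ⟨Submodule.finiteDimensional_of_le hle,
    (Submodule.finrank_mono hle).trans ((Submodule.finrank_map_le _ _).trans h2)⟩

/-- The label system of a multiplicative reflection positive parameter of bounded ranks. -/
noncomputable def IsMultiplicative.labelSystem (hf : f.IsMultiplicative)
    (hpos : f.ReflectionPositive) {q : ℕ} (hq : 0 < q)
    (hrank : ∀ k, f.rankConn k ≤ (q ^ k : ℕ)) : LabelSystem hf.patternFunction.Classes where
  A := withLabels
  mono h := withLabels_mono h
  exhaust := exists_mem_withLabels
  act := relabel
  act_one := by
    rintro ⟨x⟩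
    exact congrArg cls ((congrArg (Pattern.rename · x) Sum.map_id_id).trans (Pattern.rename_id x))
  act_mul σ τ := by
    rintro ⟨x⟩
    refine congrArg cls ((congrArg (Pattern.rename · x) ?_).trans
      (Pattern.rename_rename (Sum.map τ id) (Sum.map σ id) x).symm)
    ext (a | a) <;> simp
  act_congr := by
    rintro S _ σ τ ⟨x, hx, rfl⟩ h
    refine congrArg cls (Pattern.rename_congr ?_)
    rintro e he (a | a) ha
    · simp [h a (hx e he a ha)]
    · rfl
  act_mem := by
    rintro S _ σ ⟨x, hx, rfl⟩
    refine ⟨_, hx.rename (fun i hi j h => ?_) (fun n j h => ?_), rfl⟩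
    · rw [Sum.map_inl, Sum.inl.injEq] at h
      exact h ▸ Finset.mem_image_of_mem _ hi
    · simp at h
  F := value
  F_one := hf.edgeValue_zero
  F_act σ := by
    rintro ⟨x⟩
    exact hf.edgeValue_map (σ.injective.sumMap Function.injective_id) x
  unlabel U h := exists_unlabel U h
  pos := posSemidefOn_withLabels hf hpos
  q := q
  q_pos := hq
  fin S := (finiteDimensional_translateSpan hf (hrank S.card)).1
  rank_le S := (finiteDimensional_translateSpan hf (hrank S.card)).2

theorem prod_cls_edges {F : PatternFunction} {n : ℕ} (p : ℕ) (E : Multiset (Fin n × Fin n)) :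
    (E.map fun z => (cls {s(Sum.inl (p + z.1), Sum.inl (p + z.2))} : F.Classes)).prod =
      cls (E.map fun z => s(Sum.inl (p + z.1), Sum.inl (p + z.2))) := by
  induction E using Multiset.induction_on with
  | empty => rfl
  | cons z E ih =>
    rw [Multiset.map_cons, Multiset.prod_cons, ih, cls_mul, Multiset.map_cons,
      ← Multiset.singleton_add]
    congr 1
    refine congrArg₂ (· + ·) rfl ?_
    rw [Pattern.rename, Multiset.map_map]
    exact Multiset.map_congr rfl fun z _ => rfl

/-- The theorem for parameters that do not vanish on the graph with one node. -/
theorem IsMultiplicative.exists_weightedGraph (hf : f.IsMultiplicative)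
    (hpos : f.ReflectionPositive) {q : ℕ} (hq : 0 < q)
    (hrank : ∀ k, f.rankConn k ≤ (q ^ k : ℕ)) :
    ∃ H : WeightedGraph, ∀ G : Multigraph, f G = WeightedGraph.hom G H := by
  classical
  obtain ⟨d, α, β, p, hα, hβ, h⟩ := (hf.labelSystem hpos hq hrank).exists_weights
    (fun i j => cls {s(Sum.inl i, Sum.inl j)})
    (fun i j => ⟨_, fun e he t ht => by
      rw [Multiset.mem_singleton] at he
      subst he
      simpa using ht, rfl⟩)
    (fun i j => by rw [Sym2.eq_swap])
    (fun σ i j => rfl)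
  have hc := hf.pos
  -- The factor on the node weights undoes the normalization.
  refine ⟨⟨d, fun i => f (edgeless (Fin 1)) * α i, fun i => mul_pos hc (hα i), β, hβ⟩, fun G => ?_⟩
  let ε : G.V ≃ Fin (Fintype.card G.V) := Fintype.equivFin G.V
  let E : Multiset (Fin (Fintype.card G.V) × Fin (Fintype.card G.V)) :=
    G.E.map fun e => (ε e.out.1, ε e.out.2)
  have hout : ∀ e : Sym2 G.V, s(e.out.1, e.out.2) = e := fun e => Quot.out_eq e
  have hE : ∀ z ∈ E, z.1 ≠ z.2 := by
    intro z hz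
    obtain ⟨e, he, rfl⟩ := Multiset.mem_map.1 hz
    have := G.loopless e he
    rw [← hout e, Sym2.mk_isDiag_iff] at this
    exact fun hh => this (ε.injective hh)
  have h1 := h _ E hE
  rw [prod_cls_edges] at h1
  let j : G.V → ℕ ⊕ ℕ := fun v => Sum.inl (p + ε v)
  have hj : G.Realizes j (noLoops (E.map fun z =>
      s(Sum.inl (p + (z.1 : ℕ)), Sum.inl (p + (z.2 : ℕ))))) := by
    have hinj : Function.Injective j := fun v w hvw => ε.injective (Fin.ext (by
      have := Sum.inl_injective hvw
      omega))
    have hmap : G.E.map (Sym2.map j) =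
        E.map fun z => s(Sum.inl (p + (z.1 : ℕ)), Sum.inl (p + (z.2 : ℕ))) := by
      rw [Multiset.map_map]
      refine Multiset.map_congr rfl fun e _ => ?_
      conv_lhs => rw [← hout e]
      rfl
    refine ⟨hinj, ?_⟩
    rw [← hmap, noLoops_map hinj, noLoops_eq_self G.loopless]
  have h2 : f.normalize G = ∑ k : Fin (Fintype.card G.V) → Fin d,
      (∏ i, α (k i)) * (E.map fun z => β (k z.1) (k z.2)).prod := by
    rw [← h1]
    exact (hf.edgeValue_eq hj).symm
  rw [normalize, div_eq_iff (pow_ne_zero _ hc.ne')] at h2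
  rw [h2, WeightedGraph.hom, Finset.sum_mul]
  refine Fintype.sum_equiv (Equiv.arrowCongr ε.symm (Equiv.refl (Fin d))) _ _ fun k => ?_
  have h3 : ∏ v : G.V, f (edgeless (Fin 1)) * α (k (ε v)) =
      f (edgeless (Fin 1)) ^ Fintype.card G.V * ∏ i, α (k i) := by
    rw [Finset.prod_mul_distrib, Finset.prod_const, Finset.card_univ,
      ε.prod_comp fun i => α (k i)]
  have h4 : (E.map fun z => β (k z.1) (k z.2)).prod =
      (G.E.map fun e => β (k (ε e.out.1)) (k (ε e.out.2))).prod := by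
    rw [Multiset.map_map]
    rfl
  rw [h4, mul_right_comm, mul_comm (∏ i, α (k i)), ← h3]
  refine congrArg₂ (· * ·) rfl (congrArg Multiset.prod (Multiset.map_congr rfl fun e _ => ?_))
  conv_rhs => rw [← hout e]
  rfl

/-! ### The one-node graph and the conclusion -/

/-- The product with a single labeled node changes nothing. -/
theorem map_glue_node (G : LabeledMultigraph 1) :
    f (glue ⟨edgeless (Fin 1), Function.Embedding.refl _⟩ G).toMultigraph = f G.toMultigraph := by
  obtain ⟨j, hj, hr⟩ := exists_glue_realizes (X := G.V)
    ⟨edgeless (Fin 1), Function.Embedding.refl _⟩ G (j₁ := fun i => G.label i) (j₂ := id)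
    (x₁ := 0) (x₂ := G.E) ⟨G.label.injective, rfl⟩ ⟨Function.injective_id, by simp⟩ (fun _ => rfl)
    (fun v w h => ⟨v, rfl, h.symm⟩)
  refine f.eq_of_realizes hj (j' := id) ⟨Function.injective_id, by simp⟩ ?_
  rw [hr, Set.range_id, Set.union_univ]

theorem ReflectionPositive.node_nonneg (hpos : f.ReflectionPositive) :
    0 ≤ f (edgeless (Fin 1)) := by
  have h := (hpos 1).diag_nonneg (i := ⟦⟨edgeless (Fin 1), Function.Embedding.refl _⟩⟧)
  rwa [connectionMatrix_apply, map_glue_node] at h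

/-- A reflection positive parameter vanishing on the graph with one node vanishes on all graphs
with nodes. -/
theorem ReflectionPositive.eq_zero (hpos : f.ReflectionPositive) (h0 : f (edgeless (Fin 1)) = 0)
    (G : Multigraph) (v : G.V) : f G = 0 := by
  let K : LabeledMultigraph 1 := ⟨edgeless (Fin 1), Function.Embedding.refl _⟩
  let G' : LabeledMultigraph 1 := ⟨G, ⟨fun _ => v, Function.injective_of_subsingleton _⟩⟩
  -- The corner entry for `K` is zero, so this determinant is `-(f G) ^ 2`.
  have h := ((hpos 1).submatrix (![⟦K⟧, ⟦G'⟧] : Fin 2 → LabeledType 1)).det_nonneg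
  have hsymm := (hpos 1).isHermitian.apply (⟦G'⟧ : LabeledType 1) ⟦K⟧
  have e1 : f.connectionMatrix 1 ⟦K⟧ ⟦K⟧ = 0 := (map_glue_node K).trans h0
  have e2 : f.connectionMatrix 1 ⟦K⟧ ⟦G'⟧ = f G := map_glue_node G'
  rw [star_trivial, e2] at hsymm
  rw [Matrix.det_fin_two] at h
  simp only [Matrix.submatrix_apply, Matrix.cons_val_zero, Matrix.cons_val_one, e1, e2,
    ← hsymm] at h
  nlinarith

end GraphParameter

theorem theorem2 (f : GraphParameter) (hf₀ : f Multigraph.K₀ = 1)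
    (hpos : f.ReflectionPositive)
    (hrank : ∃ q : ℕ, 0 < q ∧ ∀ k : ℕ, f.rankConn k ≤ (q : ℕ∞) ^ k) :
    ∃ H : WeightedGraph, ∀ G : Multigraph, f G = WeightedGraph.hom G H := by
  classical
  obtain ⟨q, hq, hrank⟩ := hrank
  have hrank' : ∀ k, f.rankConn k ≤ (q ^ k : ℕ) := fun k => by
    rw [Nat.cast_pow]
    exact hrank k
  rcases hpos.node_nonneg.eq_or_lt with h0 | h0
  -- Normalization is impossible here, but `f` is `1` on the null graph and `0` elsewhere, just as
  -- for maps into the empty `H`.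
  · refine ⟨⟨0, Fin.elim0, fun i => i.elim0, 0, Matrix.isSymm_zero⟩, fun G => ?_⟩
    rcases isEmpty_or_nonempty G.V with hG | ⟨⟨v⟩⟩
    · have hE : G.E = 0 := Multiset.eq_zero_of_forall_notMem fun e _ => by
        induction e with
        | h a _ => exact isEmptyElim a
      rw [WeightedGraph.hom, Fintype.sum_unique, hE, ← hf₀.symm.trans
        (f.eq_of_realizes (X := PEmpty) (Multigraph.K₀_realizes isEmptyElim) (G' := G)
        (j' := isEmptyElim) ⟨Function.injective_of_subsingleton _, by rw [hE]; rfl⟩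
        (Set.eq_empty_of_isEmpty _ |>.trans (Set.eq_empty_of_isEmpty _).symm))]
      simp
    · have : IsEmpty (G.V → Fin 0) := ⟨fun φ => (φ v).elim0⟩
      rw [hpos.eq_zero h0.symm G v]
      exact (Fintype.sum_empty _).symm
  · have hf : f.IsMultiplicative :=
      ⟨hf₀, GraphParameter.map_glue_unlabeled hf₀ (by simpa using hrank' 0), h0⟩
    exact hf.exists_weightedGraph hpos hq hrank'
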